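/- Let $T>0$, $q\in(1,2)$, and let $h\in W^{1,q}(0,T;\mathbb{R}^2)$, identified with its continuous representative on $[0,T]$. Let $\varphi\in C^\infty_c([0,T)\times\mathbb{R}^2;\mathbb{R}^2)$ satisfy $\operatorname{div}\varphi=0$. Then for every $\eta>0$ there exists $\varphi^\eta\in W^{1,q}_c([0,T);H^1(\mathbb{R}^2;\mathbb{R}^2))$ (that is, $\varphi^\eta\in L^q(0,T;H^1)$, $\partial_t\varphi^\eta\in L^q(0,T;H^1)$, and $\varphi^\eta$, identified with its continuous representative $[0,T)\to H^1$, vanishes on $[T',T)$ for some $T'<T$), such that $$\operatorname{div}\varphi^\eta=0\quad\text{in }[0,T)\times\mathbb{R}^2,$$ $$\varphi^\eta(t,x)=0\quad\text{for } t\in[0,T),\ x\in B\left(h(t),\tfrac{\eta}{2}\right),$$ and such that, as $\eta\to0^+$, $$\varphi^\eta\overset{*}{\rightharpoonup}\varphi\quad\text{weakly-}*\text{ in } L^\infty(0,T;H^1(\mathbb{R}^2)),$$ $$\partial_t\varphi^\eta\rightharpoonup\partial_t\varphi\quad\text{weakly in } L^q(0,T;L^2(\mathbb{R}^2)).$$ 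-/

import Mathlib

open MeasureTheory Filter Set Topology
open scoped ENNReal ContDiff

noncomputable section

/-! ### The spaces `L²(ℝ²; ℝ²)` and `H¹(ℝ²; ℝ²)` -/

/-- The Euclidean plane `ℝ²`. -/
abbrev Plane : Type := EuclideanSpace ℝ (Fin 2)

/-- The canonical basis vectors of the plane. -/
abbrev planeBasis (i : Fin 2) : Plane := EuclideanSpace.single i (1 : ℝ)

/-- The space `L²(ℝ²; ℝ²)`. -/
abbrev L2Field : Type := Lp Plane 2 (volume : Measure Plane)

/-- Triples `(f, g₀, g₁)` of elements of `L²(ℝ²; ℝ²)`, with the Hilbert norm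
`(‖f‖² + ‖g₀‖² + ‖g₁‖²)^{1/2}`; `none` is the index of `f`, and `some i` is the index of `gᵢ`. -/
abbrev FieldTriple : Type := PiLp 2 (fun _ : Option (Fin 2) => L2Field)

/-- `g` is the weak (distributional) partial derivative `∂ᵢ f` on `ℝ²`. -/
def IsWeakPartial (i : Fin 2) (f g : L2Field) : Prop :=
  ∀ θ : Plane → ℝ, ContDiff ℝ ∞ θ → HasCompactSupport θ →
    ∫ x, fderiv ℝ θ x (planeBasis i) • f x = - ∫ x, θ x • g x

theorem testFunction_memLp {θ : Plane → ℝ} (hθ : Continuous θ) (hc : HasCompactSupport θ) :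
    MemLp θ 2 (volume : Measure Plane) :=
  hθ.memLp_of_hasCompactSupport hc

theorem testFunction_fderiv_memLp {θ : Plane → ℝ} (hθ : ContDiff ℝ ∞ θ)
    (hc : HasCompactSupport θ) (v : Plane) :
    MemLp (fun x => fderiv ℝ θ x v) 2 (volume : Measure Plane) :=
  testFunction_memLp ((hθ.continuous_fderiv (by simp)).clm_apply continuous_const)
    (hc.fderiv_apply (𝕜 := ℝ) v)

/-- The pairing of `f ∈ L²(ℝ²; ℝ²)` with a scalar function of `L²(ℝ²)`, as a continuous linear
map of `f`. -/
def pairL2 (θ : Plane → ℝ) (hθ : MemLp θ 2 (volume : Measure Plane)) : L2Field →L[ℝ] Plane :=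
  (ContinuousLinearMap.lsmul ℝ ℝ).lpPairing volume 2 2 (hθ.toLp θ)

theorem pairL2_apply (θ : Plane → ℝ) (hθ : MemLp θ 2 (volume : Measure Plane)) (f : L2Field) :
    pairL2 θ hθ f = ∫ x, θ x • f x := by
  rw [pairL2, ContinuousLinearMap.lpPairing_eq_integral]
  refine integral_congr_ae ?_
  filter_upwards [hθ.coeFn_toLp] with x hx
  simp [hx]

theorem isWeakPartial_iff (i : Fin 2) (f g : L2Field) :
    IsWeakPartial i f g ↔ ∀ (θ : Plane → ℝ) (h : ContDiff ℝ ∞ θ) (hc : HasCompactSupport θ),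
      pairL2 _ (testFunction_fderiv_memLp h hc (planeBasis i)) f
        + pairL2 θ (testFunction_memLp h.continuous hc) g = 0 := by
  unfold IsWeakPartial
  simp only [pairL2_apply, add_eq_zero_iff_eq_neg]

/-- The Sobolev space `H¹(ℝ²; ℝ²)`, realised as the graph of the weak gradient: the triples
`(f, ∂₀ f, ∂₁ f)` in `L²`, with the norm `(‖f‖² + ‖∂₀ f‖² + ‖∂₁ f‖²)^{1/2}`. -/
def H1Submodule : Submodule ℝ FieldTriple where
  carrier := {u | ∀ i : Fin 2, IsWeakPartial i (u none) (u (some i))}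
  add_mem' := by
    intro u v hu hv i
    have hu := (isWeakPartial_iff i _ _).1 (hu i)
    have hv := (isWeakPartial_iff i _ _).1 (hv i)
    refine (isWeakPartial_iff i _ _).2 fun θ h hc => ?_
    have h1 := hu θ h hc
    have h2 := hv θ h hc
    rw [PiLp.add_apply, PiLp.add_apply, map_add, map_add, add_add_add_comm, h1, h2, add_zero]
  zero_mem' := by
    intro i
    refine (isWeakPartial_iff i _ _).2 fun θ h hc => ?_
    rw [PiLp.zero_apply, PiLp.zero_apply, map_zero, map_zero, add_zero]
  smul_mem' := by
    intro c u hu i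
    have hu := (isWeakPartial_iff i _ _).1 (hu i)
    refine (isWeakPartial_iff i _ _).2 fun θ h hc => ?_
    rw [PiLp.smul_apply, PiLp.smul_apply, map_smul, map_smul, ← smul_add, hu θ h hc, smul_zero]

theorem isClosed_H1Submodule : IsClosed (H1Submodule : Set FieldTriple) := by
  have : (H1Submodule : Set FieldTriple) = ⋂ (i : Fin 2), ⋂ (θ : Plane → ℝ),
      ⋂ (h : ContDiff ℝ ∞ θ), ⋂ (hc : HasCompactSupport θ),
        {u : FieldTriple | pairL2 _ (testFunction_fderiv_memLp h hc (planeBasis i)) (u none)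
          + pairL2 θ (testFunction_memLp h.continuous hc) (u (some i)) = 0} := by
    ext u
    simp only [mem_iInter, mem_ofPred_eq]
    exact forall_congr' fun i => isWeakPartial_iff i _ _
  rw [this]
  refine isClosed_iInter fun i => isClosed_iInter fun θ => isClosed_iInter fun h =>
    isClosed_iInter fun hc => isClosed_eq ?_ continuous_const
  exact ((ContinuousLinearMap.continuous _).comp (PiLp.continuous_apply 2 _ none)).add
    ((ContinuousLinearMap.continuous _).comp (PiLp.continuous_apply 2 _ (some i)))

/-- The Hilbert space `H¹(ℝ²; ℝ²)`. -/
abbrev H1Field : Type := H1Submodule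

instance instCompleteSpaceH1Field : CompleteSpace H1Field :=
  isClosed_H1Submodule.completeSpace_coe

namespace H1Field

/-- The underlying `L²` vector field of an element of `H¹`. -/
def toL2 (u : H1Field) : L2Field := (u : FieldTriple) none

/-- The weak partial derivative `∂ᵢ u ∈ L²` of an element of `H¹`. -/
def partialDeriv (i : Fin 2) (u : H1Field) : L2Field := (u : FieldTriple) (some i)

/-- `div u = ∂₀ u₀ + ∂₁ u₁ = 0` almost everywhere in the plane. -/
def IsDivFree (u : H1Field) : Prop :=
  ∀ᵐ x : Plane, ∑ i : Fin 2, partialDeriv i u x i = 0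

theorem partial_memLp {f : Plane → Plane} (hf : ContDiff ℝ 1 f) (hc : HasCompactSupport f)
    (v : Plane) : MemLp (fun x => fderiv ℝ f x v) 2 (volume : Measure Plane) :=
  ((hf.continuous_fderiv (by simp)).clm_apply continuous_const).memLp_of_hasCompactSupport
    (hc.fderiv_apply (𝕜 := ℝ) v)

/-- A compactly supported `C¹` vector field, together with its classical partial derivatives, as an
element of `H¹`. -/
def ofC1 (f : Plane → Plane) (hf : ContDiff ℝ 1 f) (hc : HasCompactSupport f) : H1Field :=
  ⟨WithLp.toLp 2 fun o => Option.casesOn o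
      ((hf.continuous.memLp_of_hasCompactSupport hc : MemLp f 2 volume).toLp f)
      (fun i => (partial_memLp hf hc (planeBasis i)).toLp _), by
    intro i θ hθ hθc
    set F : L2Field := (hf.continuous.memLp_of_hasCompactSupport hc : MemLp f 2 volume).toLp f
      with hF
    set G : L2Field := (partial_memLp hf hc (planeBasis i)).toLp _ with hG
    change ∫ x, fderiv ℝ θ x (planeBasis i) • F x = - ∫ x, θ x • G x
    have h1 : ∫ x, fderiv ℝ θ x (planeBasis i) • F x
        = ∫ x, fderiv ℝ θ x (planeBasis i) • f x := by
      refine integral_congr_ae ?_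
      filter_upwards [MemLp.coeFn_toLp
        (hf.continuous.memLp_of_hasCompactSupport hc : MemLp f 2 volume)] with x hx
      rw [hF, hx]
    have h2 : ∫ x, θ x • G x = ∫ x, θ x • fderiv ℝ f x (planeBasis i) := by
      refine integral_congr_ae ?_
      filter_upwards [MemLp.coeFn_toLp (partial_memLp hf hc (planeBasis i))] with x hx
      rw [hG, hx]
    rw [h1, h2, eq_comm, neg_eq_iff_eq_neg]
    have hθd : Continuous fun x => fderiv ℝ θ x (planeBasis i) :=
      (hθ.continuous_fderiv (by simp)).clm_apply continuous_const
    have hfd : Continuous fun x => fderiv ℝ f x (planeBasis i) :=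
      (hf.continuous_fderiv (by simp)).clm_apply continuous_const
    refine integral_smul_fderiv_eq_neg_fderiv_smul_of_integrable ?_ ?_ ?_
      (fun x _ => (hθ.differentiable (by simp)).differentiableAt)
      (fun x _ => (hf.differentiable (by simp)).differentiableAt)
    · exact (hθd.smul hf.continuous).integrable_of_hasCompactSupport hc.smul_left
    · exact (hθ.continuous.smul hfd).integrable_of_hasCompactSupport hθc.smul_right
    · exact (hθ.continuous.smul hf.continuous).integrable_of_hasCompactSupport hc.smul_left⟩

open Classical in
/-- The element of `H¹` given by a vector field of the plane that is `C¹` with compact support (and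
`0` for other fields). -/
def ofField (f : Plane → Plane) : H1Field :=
  if hf : ContDiff ℝ 1 f ∧ HasCompactSupport f then ofC1 f hf.1 hf.2 else 0

theorem coeFn_toL2_ofField {f : Plane → Plane} (hf : ContDiff ℝ 1 f) (hc : HasCompactSupport f) :
    ⇑(toL2 (ofField f)) =ᵐ[volume] f := by
  rw [ofField, dif_pos ⟨hf, hc⟩]
  exact MemLp.coeFn_toLp (hf.continuous.memLp_of_hasCompactSupport hc : MemLp f 2 volume)

end H1Field

open Classical in
/-- The element of `L²` given by a square integrable vector field of the plane (and `0` for other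
fields). -/
def L2Field.ofField (f : Plane → Plane) : L2Field :=
  if hf : MemLp f 2 (volume : Measure Plane) then hf.toLp f else 0

/-! ### Bochner spaces on the time interval `(0, T)` -/

/-- Lebesgue measure on `(0, T)`. -/
abbrev timeMeasure (T : ℝ) : Measure ℝ := volume.restrict (Ioo 0 T)

section Bochner

variable {X : Type*} [NormedAddCommGroup X] [NormedSpace ℝ X] [CompleteSpace X]

/-- `v` is the weak derivative on `(0, T)` of the `X`-valued function `u`. -/
def HasWeakTimeDeriv (T : ℝ) (u v : ℝ → X) : Prop :=
  ∀ θ : ℝ → ℝ, ContDiff ℝ ∞ θ → HasCompactSupport θ → tsupport θ ⊆ Ioo 0 T →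
    ∫ t in Ioo 0 T, deriv θ t • u t = - ∫ t in Ioo 0 T, θ t • v t

/-- `u ∈ W^{1,q}(0,T;X)`, with weak derivative `v = ∂ₜ u`. -/
structure IsW1q (q : ℝ≥0∞) (T : ℝ) (u v : ℝ → X) : Prop where
  memLp : MemLp u q (timeMeasure T)
  memLp_deriv : MemLp v q (timeMeasure T)
  hasWeakTimeDeriv : HasWeakTimeDeriv T u v

/-- `u ∈ W^{1,q}_c([0,T);X)`, with weak derivative `v = ∂ₜ u`: `u` is (the continuous
representative of) an element of `W^{1,q}(0,T;X)` with compact support in `[0,T)`. -/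
structure IsW1qc (q : ℝ≥0∞) (T : ℝ) (u v : ℝ → X) : Prop extends IsW1q q T u v where
  continuousOn : ContinuousOn u (Ico 0 T)
  compactSupport : ∃ T' ∈ Ico 0 T, ∀ t ∈ Ico T' T, u t = 0

/-- Weak convergence `u i ⇀ u₀` in `L^q(0,T;X)` along the filter `l`: all the functions define
elements of `L^q(0,T;X)`, and every continuous linear functional on this space converges. -/
def WeaklyTendstoLq {ι : Type*} (q : ℝ≥0∞) [Fact (1 ≤ q)] (T : ℝ) (l : Filter ι)
    (u : ι → ℝ → X) (u₀ : ℝ → X) : Prop :=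
  ∃ (U : ι → Lp X q (timeMeasure T)) (U₀ : Lp X q (timeMeasure T)),
    (∀ᶠ i in l, U i =ᵐ[timeMeasure T] u i) ∧ U₀ =ᵐ[timeMeasure T] u₀ ∧
      ∀ Λ : StrongDual ℝ (Lp X q (timeMeasure T)),
        Tendsto (fun i => Λ (U i)) l (𝓝 (Λ U₀))

/-- Weak-* convergence `u i ⇀* u₀` in `L^∞(0,T;X)` along the filter `l`, for a Hilbert space `X`,
where `L^∞(0,T;X)` is the dual space of `L¹(0,T;X')`. -/
def WeakStarTendstoLinfty {ι : Type*} (T : ℝ) (l : Filter ι)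
    (u : ι → ℝ → X) (u₀ : ℝ → X) : Prop :=
  (∀ᶠ i in l, MemLp (u i) ∞ (timeMeasure T)) ∧ MemLp u₀ ∞ (timeMeasure T) ∧
    ∀ w : ℝ → StrongDual ℝ X, Integrable w (timeMeasure T) →
      Tendsto (fun i => ∫ t in Ioo 0 T, w t (u i t)) l (𝓝 (∫ t in Ioo 0 T, w t (u₀ t)))

end Bochner

/-! ### Test functions -/

/-- `φ ∈ C^∞_c([0,T) × ℝ²; ℝ²)`: smooth up to `t = 0`, with compact support in `[0,T) × ℝ²`.
Only the values `φ t` for `t ∈ [0,T)` matter. -/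
structure IsTestField (T : ℝ) (φ : ℝ → Plane → Plane) : Prop where
  contDiffOn : ContDiffOn ℝ ∞ (Function.uncurry φ) (Ico 0 T ×ˢ (univ : Set Plane))
  compactSupport : ∃ K : Set (ℝ × Plane), IsCompact K ∧ K ⊆ Ico 0 T ×ˢ (univ : Set Plane) ∧
    ∀ t ∈ Ico 0 T, ∀ x, (t, x) ∉ K → φ t x = 0

/-- The divergence of a differentiable vector field of the plane. -/
def classicalDiv (f : Plane → Plane) (x : Plane) : ℝ :=
  ∑ i : Fin 2, fderiv ℝ f x (planeBasis i) i

end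

/-! In the plane a compactly supported divergence-free field f is a rotated gradient ∇⊥ψ = (-∂₁ψ,
∂₀ψ), where ψ is an integral of f₀ along vertical rays. Cutting off ψ instead of f keeps the
divergence zero: if ζ is a bump equal to 1 on the disc of radius 1/2 and supported in the unit disc,
then ∇⊥((1 - ζ((x - a)/η))(ψ(t,x) - ψ(t,a))) is divergence free, vanishes for |x - a| < η/2, and
differs from f by a `correction` supported in the disc of radius η about a.

Subtracting ψ(t,a) gives the right size. On that disc ψ(t,x) - ψ(t,a) = O(η), so the correction is
O(1) and its first derivatives in t, a and x are O(1/η) (`exists_correction_bound`). Since the disc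
has area of order η², all of these are bounded in L², and a bounded family of L² that concentrates
at a point tends weakly to 0 (`tendsto_inner_ofField_of_concentrating`).

With a = h(t), the time derivative acquires the a-derivative applied to h'(t), so it is bounded in
L² by a constant times 1 + |h'(t)|, a majorant in L^q. Weak convergence at almost every time
together with such a majorant gives weak convergence in L^q(0,T;L²)
(`tendsto_strongDual_of_tendsto_inner`); with a constant majorant it gives weak-* convergence in
L^∞(0,T;H¹).

As h is only W^{1,q}, the position a is first treated as an independent variable: for fixed η the
field is a C¹ function of (t,a) with values in H¹ (`contDiff_h1Slice`), and the chain rule is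
applied along the absolutely continuous curve (t, h(t)) (`IsW1q.comp_contDiff`).

The test field is smooth only up to t = 0, whereas these constructions use fields smooth on the
whole of space-time. No extension is needed: f is shifted in time by η and cut off at negative times
(`timeShift`). The shifted slices converge strongly, so the limit is not affected. -/

noncomputable section

/-! ### Classes in L² of vector fields of the plane -/

namespace L2Field

theorem ofField_of_memLp {f : Plane → Plane} (hf : MemLp f 2 (volume : Measure Plane)) :
    L2Field.ofField f = hf.toLp f := dif_pos hf

theorem coeFn_ofField {f : Plane → Plane} (hf : MemLp f 2 (volume : Measure Plane)) :
    ⇑(L2Field.ofField f) =ᵐ[volume] f := by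
  rw [ofField_of_memLp hf]
  exact hf.coeFn_toLp

theorem ofField_add {f g : Plane → Plane} (hf : MemLp f 2 (volume : Measure Plane))
    (hg : MemLp g 2 (volume : Measure Plane)) :
    L2Field.ofField (fun x => f x + g x) = L2Field.ofField f + L2Field.ofField g := by
  rw [ofField_of_memLp hf, ofField_of_memLp hg, ← MemLp.toLp_add]
  exact ofField_of_memLp (hf.add hg)

theorem ofField_sub {f g : Plane → Plane} (hf : MemLp f 2 (volume : Measure Plane))
    (hg : MemLp g 2 (volume : Measure Plane)) :
    L2Field.ofField (fun x => f x - g x) = L2Field.ofField f - L2Field.ofField g := by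
  rw [ofField_of_memLp hf, ofField_of_memLp hg, ← MemLp.toLp_sub]
  exact ofField_of_memLp (hf.sub hg)

theorem ofField_smul {f : Plane → Plane} (c : ℝ) (hf : MemLp f 2 (volume : Measure Plane)) :
    L2Field.ofField (fun x => c • f x) = c • L2Field.ofField f := by
  rw [ofField_of_memLp hf, ← MemLp.toLp_const_smul]
  exact ofField_of_memLp (hf.const_smul c)

/-- The L² bounds on fields below reduce to this crude estimate, with s a fixed compact set or a
disc of radius η. -/
theorem norm_ofField_le {f : Plane → Plane} (hf : MemLp f 2 (volume : Measure Plane))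
    {s : Set Plane} (hs : MeasurableSet s) (hvol : volume s ≠ ⊤) {C : ℝ} (hC : 0 ≤ C)
    (hb : ∀ x ∈ s, ‖f x‖ ≤ C) (h0 : ∀ x ∉ s, f x = 0) :
    ‖L2Field.ofField f‖ ≤ C * √(volume.real s) := by
  rw [ofField_of_memLp hf, Lp.norm_toLp]
  have h1 : eLpNorm f 2 (volume : Measure Plane)
      ≤ eLpNorm (s.indicator fun _ => C) 2 (volume : Measure Plane) := by
    refine eLpNorm_mono fun x => ?_
    by_cases hx : x ∈ s
    · rw [indicator_of_mem hx]
      exact (hb x hx).trans (le_abs_self C)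
    · rw [h0 x hx]
      simp
  rw [eLpNorm_indicator_const hs (by simp) (by simp)] at h1
  have h2 := ENNReal.toReal_mono (ENNReal.mul_ne_top (by simp)
    (ENNReal.rpow_ne_top_of_nonneg (by simp) hvol)) h1
  refine h2.trans_eq ?_
  rw [ENNReal.toReal_mul, ← ENNReal.toReal_rpow, Real.sqrt_eq_rpow]
  simp [Measure.real, abs_of_nonneg hC]

theorem memLp_of_continuous {f : Plane → Plane} (hf : Continuous f) {K : Set Plane}
    (hK : IsCompact K) (h0 : ∀ x ∉ K, f x = 0) : MemLp f 2 (volume : Measure Plane) :=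
  hf.memLp_of_hasCompactSupport (HasCompactSupport.intro hK h0)

/-- Uniform convergence on a common compact set implies convergence in L². The hypotheses are local
in p because some of the fields are regular for positive times only. -/
theorem continuousAt_ofField {P : Type*} [TopologicalSpace P] {f : P → Plane → Plane} {p₀ : P}
    {K : Set Plane} (hK : IsCompact K) (hcont : ∀ᶠ p in 𝓝 p₀, Continuous (f p))
    (hsupp : ∀ᶠ p in 𝓝 p₀, ∀ x ∉ K, f p x = 0)
    (hf : ∀ x ∈ K, ContinuousAt (Function.uncurry f) (p₀, x)) :
    ContinuousAt (fun p => L2Field.ofField (f p)) p₀ := by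
  rw [Metric.continuousAt_iff']
  intro ε hε
  set c := √(volume.real K) with hc
  have hc0 : 0 ≤ c := Real.sqrt_nonneg _
  -- The denominator is c + 1 because K may be a null set.
  have hε' : 0 < ε / (c + 1) := by positivity
  have key : ∀ᶠ p in 𝓝 p₀, ∀ x ∈ K, ‖f p x - f p₀ x‖ < ε / (c + 1) := by
    refine hK.eventually_forall_of_forall_eventually (P := fun p x =>
      ‖f p x - f p₀ x‖ < ε / (c + 1)) fun x hx => ?_
    have h1 := hf x hx
    have h2 : ContinuousAt (fun z : P × Plane => f p₀ z.2) (p₀, x) :=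
      (hcont.self_of_nhds.continuousAt).comp continuousAt_snd
    have h3 := (h1.sub h2).norm
    refine h3.eventually_lt continuousAt_const ?_
    simpa using hε'
  filter_upwards [key, hcont, hsupp] with p h1 h2 h3
  have m1 := memLp_of_continuous h2 hK h3
  have m0 := memLp_of_continuous hcont.self_of_nhds hK hsupp.self_of_nhds
  rw [dist_eq_norm, ← ofField_sub m1 m0]
  refine (norm_ofField_le (m1.sub m0) hK.measurableSet hK.measure_lt_top.ne hε'.le
    (fun x hx => (h1 x hx).le) fun x hx => ?_).trans_lt ?_
  · rw [Pi.sub_apply, h3 x hx, hsupp.self_of_nhds x hx, sub_zero]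
  · rw [← hc, div_mul_eq_mul_div, div_lt_iff₀ (by positivity)]
    nlinarith

end L2Field

/-! ### Parametrized vector fields -/

section Slices

variable {P : Type*} [NormedAddCommGroup P]

/-- A parametrized vector field whose slices have supports that are locally contained in a common
compact set. -/
def HasLocallyCompactSupport (G : P × Plane → Plane) : Prop :=
  ∀ p₀, ∃ K : Set Plane, IsCompact K ∧ ∀ᶠ p in 𝓝 p₀, ∀ x ∉ K, G (p, x) = 0

/-- The slices of a parametrized vector field, as elements of `L²`. -/
def l2Slice (G : P × Plane → Plane) (p : P) : L2Field := L2Field.ofField fun x => G (p, x)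

/-- The slices of a parametrized vector field, as elements of `H¹`. -/
def h1Slice (G : P × Plane → Plane) (p : P) : H1Field := H1Field.ofField fun x => G (p, x)

namespace HasLocallyCompactSupport

variable {G F : P × Plane → Plane}

theorem sub (hG : HasLocallyCompactSupport G) (hF : HasLocallyCompactSupport F) :
    HasLocallyCompactSupport fun z => G z - F z := by
  intro p₀
  obtain ⟨K, hK, h⟩ := hG p₀
  obtain ⟨K', hK', h'⟩ := hF p₀
  refine ⟨K ∪ K', hK.union hK', ?_⟩
  filter_upwards [h, h'] with p h1 h2 x hx
  rw [mem_union, not_or] at hx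
  rw [h1 x hx.1, h2 x hx.2, sub_zero]

theorem hasCompactSupport (hG : HasLocallyCompactSupport G) (p : P) :
    HasCompactSupport fun x => G (p, x) := by
  obtain ⟨K, hK, h⟩ := hG p
  exact HasCompactSupport.intro hK h.self_of_nhds

theorem memLp (hG : HasLocallyCompactSupport G) (hc : Continuous G) (p : P) :
    MemLp (fun x => G (p, x)) 2 (volume : Measure Plane) :=
  (by fun_prop : Continuous fun x => G (p, x)).memLp_of_hasCompactSupport (hG.hasCompactSupport p)

theorem continuous_l2Slice (hG : HasLocallyCompactSupport G) (hc : Continuous G) :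
    Continuous (l2Slice G) := by
  refine continuous_iff_continuousAt.2 fun p₀ => ?_
  obtain ⟨K, hK, h⟩ := hG p₀
  exact L2Field.continuousAt_ofField (f := fun p x => G (p, x)) hK
    (.of_forall fun p => by fun_prop) h fun x _ => hc.continuousAt

end HasLocallyCompactSupport

theorem l2Slice_add {G F : P × Plane → Plane} (hG : HasLocallyCompactSupport G)
    (hF : HasLocallyCompactSupport F) (hGc : Continuous G) (hFc : Continuous F) (p : P) :
    l2Slice (fun z => G z + F z) p = l2Slice G p + l2Slice F p :=
  L2Field.ofField_add (hG.memLp hGc p) (hF.memLp hFc p)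

theorem l2Slice_smul {G : P × Plane → Plane} (hG : HasLocallyCompactSupport G)
    (hGc : Continuous G) (c : ℝ) (p : P) :
    l2Slice (fun z => c • G z) p = c • l2Slice G p :=
  L2Field.ofField_smul c (hG.memLp hGc p)

variable [NormedSpace ℝ P]

namespace HasLocallyCompactSupport

variable {G : P × Plane → Plane}

/-- The complement of K is open, so G vanishes on a full neighbourhood of (p, x); its derivatives in
all directions then inherit the local support condition. -/
theorem fderiv_eq_zero (hG : HasLocallyCompactSupport G) (p₀ : P) : ∃ K : Set Plane,
    IsCompact K ∧ ∀ᶠ p in 𝓝 p₀, ∀ x ∉ K, G (p, x) = 0 ∧ fderiv ℝ G (p, x) = 0 := by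
  obtain ⟨K, hK, h⟩ := hG p₀
  refine ⟨K, hK, ?_⟩
  filter_upwards [h, h.eventually_nhds] with p h1 h2 x hx
  refine ⟨h1 x hx, ?_⟩
  have : G =ᶠ[𝓝 (p, x)] fun _ => (0 : Plane) := by
    rw [nhds_prod_eq]
    filter_upwards [h2.prod_mk (hK.isClosed.isOpen_compl.mem_nhds hx)] with z hz
    exact hz.1 z.2 hz.2
  rw [this.fderiv_eq]
  simp

theorem fderiv_apply (hG : HasLocallyCompactSupport G) (v : P × Plane) :
    HasLocallyCompactSupport fun z => fderiv ℝ G z v := by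
  intro p₀
  obtain ⟨K, hK, h⟩ := hG.fderiv_eq_zero p₀
  refine ⟨K, hK, h.mono fun p hp x hx => ?_⟩
  simp [(hp x hx).2]

end HasLocallyCompactSupport

variable [FiniteDimensional ℝ P] {G : P × Plane → Plane}

/-- The derivative of `l2Slice G`. -/
def l2SliceDeriv (hG : HasLocallyCompactSupport G) (hd : ContDiff ℝ 1 G) (p : P) :
    P →L[ℝ] L2Field :=
  LinearMap.toContinuousLinearMap
    { toFun := fun k => l2Slice (fun z => fderiv ℝ G z (k, 0)) p
      map_add' := fun k k' => by
        have hc := hd.continuous_fderiv (by simp)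
        rw [← l2Slice_add (hG.fderiv_apply _) (hG.fderiv_apply _)
          (hc.clm_apply continuous_const) (hc.clm_apply continuous_const)]
        simp_rw [← map_add, Prod.mk_add_mk, add_zero]
      map_smul' := fun c k => by
        have hc := hd.continuous_fderiv (by simp)
        rw [RingHom.id_apply, ← l2Slice_smul (hG.fderiv_apply _) (hc.clm_apply continuous_const)]
        simp_rw [← map_smul, Prod.smul_mk, smul_zero] }

theorem l2SliceDeriv_apply (hG : HasLocallyCompactSupport G) (hd : ContDiff ℝ 1 G) (p k : P) :
    l2SliceDeriv hG hd p k = l2Slice (fun z => fderiv ℝ G z (k, 0)) p := rfl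

/-- The derivative of G is uniformly close on K to its value at p₀. The mean value inequality in p
makes the remainder o(‖p - p₀‖) uniformly in x, hence in L², as K has finite area. -/
theorem hasFDerivAt_l2Slice (hG : HasLocallyCompactSupport G) (hd : ContDiff ℝ 1 G) (p₀ : P) :
    HasFDerivAt (l2Slice G) (l2SliceDeriv hG hd p₀) p₀ := by
  have hfc := hd.continuous_fderiv (by simp)
  obtain ⟨K, hK, hK0⟩ := hG.fderiv_eq_zero p₀
  rw [hasFDerivAt_iff_isLittleO, Asymptotics.isLittleO_iff]
  intro ε hε
  set c := √(volume.real K) with hc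
  have hc0 : 0 ≤ c := Real.sqrt_nonneg _
  have hε' : 0 < ε / (c + 1) := by positivity
  have key : ∀ᶠ p in 𝓝 p₀, ∀ x ∈ K, ‖fderiv ℝ G (p, x) - fderiv ℝ G (p₀, x)‖ < ε / (c + 1) := by
    refine hK.eventually_forall_of_forall_eventually (P := fun p x =>
      ‖fderiv ℝ G (p, x) - fderiv ℝ G (p₀, x)‖ < ε / (c + 1)) fun x hx => ?_
    have h3 : Continuous fun z : P × Plane => ‖fderiv ℝ G (z.1, z.2) - fderiv ℝ G (p₀, z.2)‖ := by
      fun_prop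
    refine h3.continuousAt.eventually_lt continuousAt_const ?_
    simpa using hε'
  obtain ⟨δ, hδ, hball⟩ := Metric.eventually_nhds_iff_ball.1 key
  filter_upwards [Metric.ball_mem_nhds p₀ hδ, hK0] with p hp hp0
  have m1 := hG.memLp hd.continuous p
  have m0 := hG.memLp hd.continuous p₀
  have mD := (hG.fderiv_apply (p - p₀, 0)).memLp (hfc.clm_apply continuous_const) p₀
  rw [l2SliceDeriv_apply, l2Slice, l2Slice, l2Slice, ← L2Field.ofField_sub m1 m0,
    ← L2Field.ofField_sub (f := fun x => G (p, x) - G (p₀, x)) (m1.sub m0) mD]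
  refine (L2Field.norm_ofField_le ((m1.sub m0).sub mD) hK.measurableSet hK.measure_lt_top.ne
    (C := ε / (c + 1) * ‖p - p₀‖) (by positivity) (fun x hx => ?_) fun x hx => ?_).trans ?_
  · have h := (convex_ball p₀ δ).norm_image_sub_le_of_norm_hasFDerivWithin_le'
      (f := fun q => G (q, x)) (f' := fun q => (fderiv ℝ G (q, x)).comp (.inl ℝ P Plane))
      (φ := (fderiv ℝ G (p₀, x)).comp (.inl ℝ P Plane)) (C := ε / (c + 1))
      (fun q hq => ?_) (fun q hq => ?_) (Metric.mem_ball_self hδ) hp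
    · simpa using h
    · have h1 : HasFDerivAt (fun q : P => (q, x)) (.inl ℝ P Plane) q := hasFDerivAt_prodMk_left q x
      exact (((hd.differentiable (by simp)) (q, x)).hasFDerivAt.comp q h1).hasFDerivWithinAt
    · rw [← ContinuousLinearMap.sub_comp]
      refine (ContinuousLinearMap.opNorm_comp_le _ _).trans ?_
      refine (mul_le_mul_of_nonneg_left (ContinuousLinearMap.norm_inl_le_one ℝ P Plane)
        (norm_nonneg _)).trans ?_
      rw [mul_one]
      exact (hball q hq x hx).le
  · simp [(hp0 x hx).1, (hK0.self_of_nhds x hx).1, (hK0.self_of_nhds x hx).2]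
  · rw [← hc]
    have h1 : ε / (c + 1) * ‖p - p₀‖ * c = ε * ‖p - p₀‖ * (c / (c + 1)) := by ring
    rw [h1]
    exact mul_le_of_le_one_right (by positivity) ((div_le_one (by positivity)).2 (by linarith))

end Slices

/-! ### Elements of H¹ through their components -/

instance instT2SpaceH1Field : T2Space H1Field :=
  T2Space.of_injective_continuous Subtype.val_injective continuous_subtype_val

namespace H1Field

/-- The components of an element of `H¹`: the field itself for `none`, and its partial derivatives
for `some j`. -/
def component (o : Option (Fin 2)) : H1Field →L[ℝ] L2Field :=
  (PiLp.proj 2 (fun _ : Option (Fin 2) => L2Field) o).comp H1Submodule.subtypeL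

theorem component_none (u : H1Field) : component none u = u.toL2 := rfl

theorem component_some (u : H1Field) (j : Fin 2) : component (some j) u = partialDeriv j u := rfl

/-- The ℓ² norm is at most the ℓ¹ norm. This reduces continuity, differentiability and boundedness
in H¹ to the same facts in L². -/
theorem norm_le_sum_component (u : H1Field) : ‖u‖ ≤ ∑ o, ‖component o u‖ := by
  have h : ‖u‖ = √(∑ o, ‖component o u‖ ^ 2) := PiLp.norm_eq_of_L2 (u : FieldTriple)
  rw [h]
  refine Real.sqrt_le_iff.2 ⟨by positivity, ?_⟩
  exact Finset.sum_sq_le_sq_sum_of_nonneg fun i _ => norm_nonneg _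

theorem inner_eq_sum_component (u v : H1Field) :
    inner ℝ u v = ∑ o, inner ℝ (component o u) (component o v) :=
  PiLp.inner_apply (u : FieldTriple) (v : FieldTriple)

theorem continuousAt_of_component {P : Type*} [TopologicalSpace P] {u : P → H1Field} {p₀ : P}
    (h : ∀ o, ContinuousAt (fun p => component o (u p)) p₀) : ContinuousAt u p₀ := by
  have hs : Tendsto (fun p => ∑ o, ‖component o (u p - u p₀)‖) (𝓝 p₀) (𝓝 0) := by
    rw [← Finset.sum_const_zero (s := (Finset.univ : Finset (Option (Fin 2))))]
    refine tendsto_finsetSum _ fun o _ => ?_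
    simpa only [map_sub] using tendsto_iff_norm_sub_tendsto_zero.1 (h o).tendsto
  exact tendsto_iff_norm_sub_tendsto_zero.2
    (squeeze_zero (fun _ => norm_nonneg _) (fun _ => norm_le_sum_component _) hs)

theorem ext_component {u v : H1Field} (h : ∀ o, component o u = component o v) : u = v := by
  refine Subtype.ext ?_
  ext1 o
  exact h o

end H1Field

namespace H1Field

theorem component_ofField_none {f : Plane → Plane} (hf : ContDiff ℝ 1 f)
    (hc : HasCompactSupport f) : component none (ofField f) = L2Field.ofField f := by
  rw [ofField, dif_pos ⟨hf, hc⟩,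
    L2Field.ofField_of_memLp (hf.continuous.memLp_of_hasCompactSupport hc)]
  rfl

theorem component_ofField_some {f : Plane → Plane} (hf : ContDiff ℝ 1 f)
    (hc : HasCompactSupport f) (j : Fin 2) :
    component (some j) (ofField f) = L2Field.ofField fun x => fderiv ℝ f x (planeBasis j) := by
  rw [ofField, dif_pos ⟨hf, hc⟩, L2Field.ofField_of_memLp (partial_memLp hf hc _)]
  rfl

end H1Field

/-! ### Slices with values in H¹ and their differentiability -/

section H1Slices

variable {P : Type*} [NormedAddCommGroup P] [NormedSpace ℝ P] {G F : P × Plane → Plane}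

/-- The field itself for `none`, and its partial derivatives in the space variable for `some j`. -/
def spatial (o : Option (Fin 2)) (G : P × Plane → Plane) : P × Plane → Plane :=
  Option.casesOn o G fun j z => fderiv ℝ G z (0, planeBasis j)

theorem HasLocallyCompactSupport.spatial (hG : HasLocallyCompactSupport G) (o : Option (Fin 2)) :
    HasLocallyCompactSupport (spatial o G) := by
  cases o with
  | none => exact hG
  | some j => exact hG.fderiv_apply _

theorem contDiff_spatial (hG : ContDiff ℝ ∞ G) (o : Option (Fin 2)) :
    ContDiff ℝ ∞ (spatial o G) := by
  cases o with
  | none => exact hG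
  | some j => exact (hG.fderiv_right (by simp)).clm_apply contDiff_const

/-- Symmetry of the second derivative: the space gradient of a parameter derivative is the parameter
derivative of the space gradient, so the derivatives of the components fit together into an element
of H¹. -/
theorem spatial_fderiv_apply (hG : ContDiff ℝ ∞ G) (o : Option (Fin 2)) (v : P × Plane) :
    spatial o (fun z => fderiv ℝ G z v) = fun z => fderiv ℝ (spatial o G) z v := by
  cases o with
  | none => rfl
  | some j =>
    funext z
    have h1 : DifferentiableAt ℝ (fderiv ℝ G) z :=
      (hG.fderiv_right (m := 1) (by norm_cast)).differentiable (by simp) z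
    have h2 : IsSymmSndFDerivAt ℝ G z := hG.contDiffAt.isSymmSndFDerivAt (by simp; norm_cast)
    change fderiv ℝ (fun z => fderiv ℝ G z v) z (0, planeBasis j)
      = fderiv ℝ (fun z => fderiv ℝ G z (0, planeBasis j)) z v
    rw [fderiv_clm_apply h1 (differentiableAt_const _),
      fderiv_clm_apply h1 (differentiableAt_const _)]
    simpa using h2.eq _ _

theorem hasFDerivAt_slice (hG : Differentiable ℝ G) (p : P) (x : Plane) :
    HasFDerivAt (fun x => G (p, x)) ((fderiv ℝ G (p, x)).comp (.inr ℝ P Plane)) x :=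
  (hG (p, x)).hasFDerivAt.comp x (hasFDerivAt_prodMk_right p x)

theorem component_h1Slice (hG : HasLocallyCompactSupport G) (hd : ContDiff ℝ 1 G)
    (o : Option (Fin 2)) (p : P) :
    H1Field.component o (h1Slice G p) = l2Slice (spatial o G) p := by
  have h1 : ContDiff ℝ 1 fun x => G (p, x) := hd.comp (contDiff_prodMk_right p)
  cases o with
  | none => exact H1Field.component_ofField_none h1 (hG.hasCompactSupport p)
  | some j =>
    refine (H1Field.component_ofField_some h1 (hG.hasCompactSupport p) j).trans ?_
    refine congrArg L2Field.ofField (funext fun x => ?_)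
    rw [(hasFDerivAt_slice (hd.differentiable (by simp)) p x).fderiv]
    rfl

theorem component_h1Slice_fderiv_apply (hG : HasLocallyCompactSupport G) (hd : ContDiff ℝ ∞ G)
    (o : Option (Fin 2)) (p : P) (v : P × Plane) :
    H1Field.component o (h1Slice (fun z => fderiv ℝ G z v) p)
      = l2Slice (fun z => fderiv ℝ (spatial o G) z v) p := by
  rw [component_h1Slice (hG.fderiv_apply _)
    (((hd.fderiv_right (m := 1) (by norm_cast)).clm_apply contDiff_const)), spatial_fderiv_apply hd]

theorem continuous_h1Slice (hG : HasLocallyCompactSupport G) (hd : ContDiff ℝ ∞ G) :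
    Continuous (h1Slice G) := by
  refine continuous_iff_continuousAt.2 fun p₀ => H1Field.continuousAt_of_component fun o => ?_
  simp_rw [component_h1Slice hG (hd.of_le (by norm_cast))]
  exact ((hG.spatial o).continuous_l2Slice (contDiff_spatial hd o).continuous).continuousAt

variable [FiniteDimensional ℝ P]

/-- The derivative of `h1Slice G`. -/
def h1SliceDeriv (hG : HasLocallyCompactSupport G) (hd : ContDiff ℝ ∞ G) (p : P) :
    P →L[ℝ] H1Field :=
  LinearMap.toContinuousLinearMap
    { toFun := fun k => h1Slice (fun z => fderiv ℝ G z (k, 0)) p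
      map_add' := fun k k' => H1Field.ext_component fun o => by
        have := (l2SliceDeriv (hG.spatial o)
          ((contDiff_spatial hd o).of_le (by norm_cast)) p).map_add k k'
        rw [map_add]
        simpa only [component_h1Slice_fderiv_apply hG hd, l2SliceDeriv_apply] using this
      map_smul' := fun c k => H1Field.ext_component fun o => by
        have := (l2SliceDeriv (hG.spatial o)
          ((contDiff_spatial hd o).of_le (by norm_cast)) p).map_smul c k
        rw [map_smul, RingHom.id_apply]
        simpa only [component_h1Slice_fderiv_apply hG hd, l2SliceDeriv_apply] using this }

theorem h1SliceDeriv_apply (hG : HasLocallyCompactSupport G) (hd : ContDiff ℝ ∞ G) (p k : P) :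
    h1SliceDeriv hG hd p k = h1Slice (fun z => fderiv ℝ G z (k, 0)) p := rfl

theorem hasFDerivAt_h1Slice (hG : HasLocallyCompactSupport G) (hd : ContDiff ℝ ∞ G) (p₀ : P) :
    HasFDerivAt (h1Slice G) (h1SliceDeriv hG hd p₀) p₀ := by
  rw [hasFDerivAt_iff_isLittleO]
  have hsum : (fun p => ∑ o, ‖H1Field.component o
      (h1Slice G p - h1Slice G p₀ - h1SliceDeriv hG hd p₀ (p - p₀))‖) =o[𝓝 p₀]
        fun p => p - p₀ := by
    refine Asymptotics.IsLittleO.fun_sum fun o _ => ?_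
    have hd1 : ContDiff ℝ 1 (spatial o G) := (contDiff_spatial hd o).of_le (by norm_cast)
    have := (hasFDerivAt_iff_isLittleO.1 (hasFDerivAt_l2Slice (hG.spatial o) hd1 p₀)).norm_left
    refine this.congr_left fun p => ?_
    rw [map_sub (H1Field.component o), map_sub (H1Field.component o),
      component_h1Slice hG (hd.of_le (by norm_cast)),
      component_h1Slice hG (hd.of_le (by norm_cast)), h1SliceDeriv_apply,
      component_h1Slice_fderiv_apply hG hd, l2SliceDeriv_apply]
  exact (Asymptotics.isBigO_of_le _ fun p =>
    (H1Field.norm_le_sum_component _).trans (le_abs_self _)).trans_isLittleO hsum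

theorem fderiv_h1Slice_apply (hG : HasLocallyCompactSupport G) (hd : ContDiff ℝ ∞ G) (p k : P) :
    fderiv ℝ (h1Slice G) p k = h1Slice (fun z => fderiv ℝ G z (k, 0)) p := by
  rw [(hasFDerivAt_h1Slice hG hd p).fderiv, h1SliceDeriv_apply]

theorem contDiff_h1Slice (hG : HasLocallyCompactSupport G) (hd : ContDiff ℝ ∞ G) :
    ContDiff ℝ 1 (h1Slice G) := by
  refine contDiff_one_iff_fderiv.2
    ⟨fun p => (hasFDerivAt_h1Slice hG hd p).differentiableAt, continuous_clm_apply.2 fun k => ?_⟩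
  simp_rw [fderiv_h1Slice_apply hG hd]
  exact continuous_h1Slice (hG.fderiv_apply _)
    ((hd.fderiv_right (by simp)).clm_apply contDiff_const)

end H1Slices

/-! ### The chain rule in `W^{1,q}` -/

-- The sums of increments that define absolute continuity are dominated, up to the factor C, by
-- those of w.
open AbsolutelyContinuousOnInterval in
theorem AbsolutelyContinuousOnInterval.of_dist_le {X : Type*} [PseudoMetricSpace X] {f : ℝ → X}
    {w : ℝ → ℝ} {a b C : ℝ} (hw : AbsolutelyContinuousOnInterval w a b)
    (h : ∀ s ∈ uIcc a b, ∀ t ∈ uIcc a b, dist (f s) (f t) ≤ C * dist (w s) (w t)) :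
    AbsolutelyContinuousOnInterval f a b := by
  have hw' := Tendsto.const_mul C hw
  rw [mul_zero] at hw'
  refine squeeze_zero' (.of_forall fun E => Finset.sum_nonneg fun _ _ => dist_nonneg) ?_ hw'
  filter_upwards [mem_inf_of_right (mem_principal_self (disjWithin a b))] with E hE
  rw [Finset.mul_sum]
  exact Finset.sum_le_sum fun i hi => h _ (hE.1 i hi).1 _ (hE.1 i hi).2

/-- A compact subset of an open interval is contained in a compact subinterval. -/
theorem exists_Icc_of_isCompact_subset_Ioo {a b : ℝ} (hab : a < b) {K : Set ℝ} (hK : IsCompact K)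
    (h : K ⊆ Ioo a b) : ∃ c d, a < c ∧ c ≤ d ∧ d < b ∧ K ⊆ Icc c d := by
  rcases K.eq_empty_or_nonempty with rfl | hne
  · exact ⟨(a + b) / 2, (a + b) / 2, by linarith, le_rfl, by linarith, empty_subset _⟩
  · have h1 := h (hK.sInf_mem hne)
    have h2 := h (hK.sSup_mem hne)
    exact ⟨sInf K, sSup K, h1.1, csInf_le_csSup hne hK.bddBelow hK.bddAbove, h2.2, fun x hx =>
      ⟨csInf_le hK.bddBelow hx, le_csSup hK.bddAbove hx⟩⟩

/-- The primitive that starts at the left end of an interval containing the support; the zero mean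
makes it vanish again beyond the right end. -/
theorem exists_testFunction_deriv_eq {T : ℝ} (hT : 0 < T) {θ : ℝ → ℝ} (hθ : ContDiff ℝ ∞ θ)
    (hc : HasCompactSupport θ) (hs : tsupport θ ⊆ Ioo 0 T) (h0 : ∫ t, θ t = 0) :
    ∃ Θ : ℝ → ℝ, ContDiff ℝ ∞ Θ ∧ HasCompactSupport Θ ∧ tsupport Θ ⊆ Ioo 0 T ∧ deriv Θ = θ := by
  obtain ⟨a, b, ha, hab, hb, hK⟩ := exists_Icc_of_isCompact_subset_Ioo hT hc hs
  have hz : ∀ t, t ∉ Icc a b → θ t = 0 := fun t ht =>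
    image_eq_zero_of_notMem_tsupport fun h => ht (hK h)
  have hd : ∀ t, HasDerivAt (fun t => ∫ s in a..t, θ s) (θ t) t := fun t =>
    intervalIntegral.integral_hasDerivAt_right (hθ.continuous.intervalIntegrable _ _)
      hθ.continuous.aestronglyMeasurable.stronglyMeasurableAtFilter hθ.continuous.continuousAt
  have hderiv : deriv (fun t => ∫ s in a..t, θ s) = θ := funext fun t => (hd t).deriv
  -- The point a belongs to `Icc a b`, so `hz` does not cover it; it is discarded as a null set.
  have hne : ∀ᵐ s : ℝ, s ≠ a := by simp [ae_iff]
  have hout : ∀ t, t ∉ Icc a b → ∫ s in a..t, θ s = 0 := by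
    intro t ht
    rw [mem_Icc, not_and_or, not_le, not_le] at ht
    rcases ht with ht | ht
    · refine intervalIntegral.integral_zero_ae ?_
      filter_upwards [hne] with s hs hst
      rw [uIoc_of_ge ht.le] at hst
      exact hz s fun h => hs (le_antisymm hst.2 h.1)
    · have h1 : ∫ s in a..t, θ s = ∫ s, θ s := by
        rw [intervalIntegral.integral_of_le (by linarith), ← integral_indicator measurableSet_Ioc]
        refine integral_congr_ae ?_
        filter_upwards [hne] with s hs
        by_cases hs' : s ∈ Ioc a t
        · rw [indicator_of_mem hs']
        · rw [indicator_of_notMem hs', hz s]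
          exact fun h => hs' ⟨lt_of_le_of_ne h.1 hs.symm, h.2.trans ht.le⟩
      rw [h1, h0]
  have hsupp : tsupport (fun t => ∫ s in a..t, θ s) ⊆ Icc a b :=
    closure_minimal (fun t ht => by_contra fun h => ht (hout t h)) isClosed_Icc
  refine ⟨fun t => ∫ s in a..t, θ s, ?_, ?_, ?_, hderiv⟩
  · rw [contDiff_infty_iff_deriv]
    exact ⟨fun t => (hd t).differentiableAt, by rwa [hderiv]⟩
  · exact HasCompactSupport.intro isCompact_Icc hout
  · exact hsupp.trans fun t ht => ⟨ha.trans_le ht.1, ht.2.trans_lt hb⟩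

/-- The lemma of du Bois-Reymond. -/
theorem exists_eq_const_of_integral_deriv_mul_eq_zero {T : ℝ} (hT : 0 < T) {u : ℝ → ℝ}
    (hu : ContinuousOn u (Icc 0 T))
    (h : ∀ θ : ℝ → ℝ, ContDiff ℝ ∞ θ → HasCompactSupport θ → tsupport θ ⊆ Ioo 0 T →
      ∫ t in Ioo 0 T, deriv θ t * u t = 0) : ∃ c, ∀ t ∈ Icc 0 T, u t = c := by
  -- With outer radius T/4 the support is [T/4, 3T/4], inside (0, T).
  let β : ContDiffBump (T / 2) := ⟨T / 8, T / 4, by positivity, by linarith⟩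
  set θ₀ : ℝ → ℝ := β.normed volume with hθ₀
  have hc0 : HasCompactSupport θ₀ := β.hasCompactSupport_normed
  have hd0 : ContDiff ℝ ∞ θ₀ := β.contDiff_normed
  have hs0 : tsupport θ₀ ⊆ Ioo 0 T := by
    rw [hθ₀, β.tsupport_normed_eq, Real.closedBall_eq_Icc]
    intro t ht
    have h1 := ht.1
    have h2 := ht.2
    change T / 2 - T / 4 ≤ t at h1
    change t ≤ T / 2 + T / 4 at h2
    constructor <;> linarith
  have hi0 : ∫ t, θ₀ t = 1 := β.integral_normed
  set c := ∫ t in Ioo 0 T, θ₀ t * u t with hc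
  have huI : IntegrableOn u (Ioo 0 T) := (hu.integrableOn_Icc).mono_set Ioo_subset_Icc_self
  have hmul : ∀ θ : ℝ → ℝ, Continuous θ → IntegrableOn (fun t => θ t * u t) (Ioo 0 T) :=
    fun θ hθ => ((hθ.continuousOn.mul hu).integrableOn_Icc).mono_set Ioo_subset_Icc_self
  have hae : ∀ᵐ t, t ∈ Ioo 0 T → u t - c = 0 := by
    refine isOpen_Ioo.ae_eq_zero_of_integral_contDiff_smul_eq_zero
      ((huI.sub (integrableOn_const (by simp))).locallyIntegrableOn) fun θ hθ hθc hθs => ?_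
    have hi : ∀ g : ℝ → ℝ, tsupport g ⊆ Ioo 0 T → ∀ v : ℝ → ℝ,
        ∫ t in Ioo 0 T, g t * v t = ∫ t, g t * v t := fun g hg v =>
      setIntegral_eq_integral_of_forall_compl_eq_zero fun t ht => by
        rw [image_eq_zero_of_notMem_tsupport fun h => ht (hg h), zero_mul]
    set I := ∫ t, θ t with hI
    have hsub : tsupport (fun t => θ t - I * θ₀ t) ⊆ Ioo 0 T := by
      refine (tsupport_sub _ _).trans (union_subset hθs ?_)
      exact (tsupport_mul_subset_right (f := fun _ => I) (g := θ₀)).trans hs0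
    -- As θ₀ has integral 1, θ - Iθ₀ has mean zero and is the derivative of an admissible test
    -- function.
    obtain ⟨Θ, hΘ1, hΘ2, hΘ3, hΘ4⟩ := exists_testFunction_deriv_eq hT
      (hθ.sub (contDiff_const.mul hd0)) (hθc.sub (hc0.mul_left (f := fun _ => I))) hsub (by
        rw [integral_sub (hθ.continuous.integrable_of_hasCompactSupport hθc)
          ((hd0.continuous.integrable_of_hasCompactSupport hc0).const_mul I),
          integral_const_mul, hi0, mul_one, sub_self])
    have h1 := h Θ hΘ1 hΘ2 hΘ3
    rw [hΘ4] at h1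
    simp_rw [smul_eq_mul]
    rw [← hi θ hθs]
    have h2 : ∫ t in Ioo 0 T, θ t = I := by
      have := hi θ hθs (fun _ => 1)
      simpa using this
    have h3 : ∫ t in Ioo 0 T, (θ t - I * θ₀ t) * u t
        = ∫ t in Ioo 0 T, (θ t * u t - I * (θ₀ t * u t)) := by
      refine integral_congr_ae (.of_forall fun t => ?_)
      ring
    rw [h3, integral_sub (hmul θ hθ.continuous) ((hmul θ₀ hd0.continuous).const_mul I),
      integral_const_mul] at h1
    have h4 : ∫ t in Ioo 0 T, θ t * (u t - c)
        = ∫ t in Ioo 0 T, (θ t * u t - θ t * c) := by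
      refine integral_congr_ae (.of_forall fun t => ?_)
      ring
    rw [h4, integral_sub (hmul θ hθ.continuous)
      ((hθ.continuous.integrable_of_hasCompactSupport hθc).integrableOn.mul_const c),
      integral_mul_const, h2]
    exact h1
  refine ⟨c, ?_⟩
  have hIoo : EqOn u (fun _ => c) (Ioo 0 T) := by
    refine Measure.eqOn_open_of_ae_eq (μ := volume) ?_ isOpen_Ioo
      (hu.mono Ioo_subset_Icc_self) continuousOn_const
    rw [EventuallyEq, ae_restrict_iff' measurableSet_Ioo]
    filter_upwards [hae] with t ht h
    linarith [ht h]
  exact fun t ht => hIoo.of_subset_closure hu continuousOn_const Ioo_subset_Icc_self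
    (by rw [closure_Ioo hT.ne]) ht

/-- The primitive of g' is absolutely continuous, so integration by parts shows that its weak
derivative is g'. Its difference with g has zero weak derivative and is constant by du Bois-Reymond.
-/
theorem eq_add_integral_of_weakDeriv {T : ℝ} (hT : 0 < T) {g g' : ℝ → ℝ}
    (hg : ContinuousOn g (Icc 0 T)) (hg' : IntegrableOn g' (Ioo 0 T))
    (h : ∀ θ : ℝ → ℝ, ContDiff ℝ ∞ θ → HasCompactSupport θ → tsupport θ ⊆ Ioo 0 T →
      ∫ t in Ioo 0 T, deriv θ t * g t = - ∫ t in Ioo 0 T, θ t * g' t) :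
    ∀ t ∈ Icc 0 T, g t = g 0 + ∫ s in 0..t, g' s := by
  have hI : IntervalIntegrable g' volume 0 T := by
    rwa [intervalIntegrable_iff_integrableOn_Ioo_of_le hT.le]
  have hAC : AbsolutelyContinuousOnInterval (fun t => ∫ s in 0..t, g' s) 0 T :=
    hI.absolutelyContinuousOnInterval_intervalIntegral left_mem_uIcc
  have hHc : ContinuousOn (fun t => ∫ s in 0..t, g' s) (Icc 0 T) := by
    have := hAC.continuousOn
    rwa [uIcc_of_le hT.le] at this
  have hweak : ∀ θ : ℝ → ℝ, ContDiff ℝ ∞ θ → HasCompactSupport θ → tsupport θ ⊆ Ioo 0 T →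
      ∫ t in Ioo 0 T, deriv θ t * (g t - ∫ s in 0..t, g' s) = 0 := by
    intro θ hθ hθc hθs
    have hz : ∀ t, t ∉ Ioo 0 T → θ t = 0 := fun t ht =>
      image_eq_zero_of_notMem_tsupport fun h => ht (hθs h)
    have hparts := (((hθ.of_le (by norm_cast)).contDiffOn :
      ContDiffOn ℝ 1 θ (uIcc 0 T)).absolutelyContinuousOnInterval).integral_mul_deriv_eq_deriv_mul
        hAC
    rw [hz 0 (by simp), hz T (by simp)] at hparts
    have hcongr : ∫ t in 0..T, θ t * deriv (fun t => ∫ s in 0..t, g' s) t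
        = ∫ t in 0..T, θ t * g' t := by
      refine intervalIntegral.integral_congr_ae ?_
      filter_upwards [hI.ae_hasDerivAt_integral] with t ht h
      rw [(ht (uIoc_subset_uIcc h) 0 left_mem_uIcc).deriv]
    rw [hcongr, zero_mul, zero_mul, sub_zero, zero_sub, intervalIntegral.integral_of_le hT.le,
      intervalIntegral.integral_of_le hT.le, integral_Ioc_eq_integral_Ioo,
      integral_Ioc_eq_integral_Ioo] at hparts
    have hθ' : Continuous (deriv θ) := hθ.continuous_deriv (by simp)
    have h1 := h θ hθ hθc hθs
    have h2 : ∫ t in Ioo 0 T, deriv θ t * (g t - ∫ s in 0..t, g' s)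
        = ∫ t in Ioo 0 T, (deriv θ t * g t - deriv θ t * ∫ s in 0..t, g' s) := by
      refine integral_congr_ae (.of_forall fun t => ?_)
      ring
    have m1 : IntegrableOn (fun t => deriv θ t * g t) (Ioo 0 T) :=
      ((hθ'.continuousOn.mul hg).integrableOn_Icc).mono_set Ioo_subset_Icc_self
    have m2 : IntegrableOn (fun t => deriv θ t * ∫ s in 0..t, g' s) (Ioo 0 T) :=
      ((hθ'.continuousOn.mul hHc).integrableOn_Icc).mono_set Ioo_subset_Icc_self
    rw [h2, integral_sub m1 m2]
    linarith
  obtain ⟨c, hc⟩ := exists_eq_const_of_integral_deriv_mul_eq_zero hT (hg.sub hHc) hweak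
  intro t ht
  have h0 : g 0 - ∫ s in 0..0, g' s = c := hc 0 (left_mem_Icc.2 hT.le)
  have h1 : g t - ∫ s in 0..t, g' s = c := hc t ht
  rw [intervalIntegral.integral_same] at h0
  linarith

namespace IsW1q

variable {q : ℝ≥0∞} {T : ℝ} {h h' : ℝ → Plane}

theorem eq_add_integral (hq : 1 ≤ q) (hT : 0 < T) (hW : IsW1q q T h h')
    (hcont : ContinuousOn h (Icc 0 T)) : ∀ t ∈ Icc 0 T, h t = h 0 + ∫ s in 0..t, h' s := by
  have hI : IntegrableOn h' (Ioo 0 T) := hW.memLp_deriv.integrable hq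
  intro t ht
  have hIt : IntervalIntegrable h' volume 0 t := by
    rw [intervalIntegrable_iff_integrableOn_Ioo_of_le ht.1]
    exact hI.mono_set (Ioo_subset_Ioo_right ht.2)
  ext i
  have key := eq_add_integral_of_weakDeriv hT (g := fun t => h t i) (g' := fun t => h' t i)
    ((EuclideanSpace.proj (𝕜 := ℝ) i).continuous.comp_continuousOn hcont)
    ((EuclideanSpace.proj (𝕜 := ℝ) i).integrable_comp hI) (fun θ hθ hθc hθs => ?_) t ht
  · rw [key, PiLp.add_apply]
    congr 1
    exact (EuclideanSpace.proj (𝕜 := ℝ) i).intervalIntegral_comp_comm hIt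
  · have h1 := congrArg (EuclideanSpace.proj (𝕜 := ℝ) i) (hW.hasWeakTimeDeriv θ hθ hθc hθs)
    have m1 : IntegrableOn (fun t => deriv θ t • h t) (Ioo 0 T) :=
      (((hθ.continuous_deriv (by simp)).continuousOn.smul hcont).integrableOn_Icc).mono_set
        Ioo_subset_Icc_self
    obtain ⟨C, hC⟩ := hθc.exists_bound_of_continuous hθ.continuous
    have m2 : IntegrableOn (fun t => θ t • h' t) (Ioo 0 T) :=
      hI.bdd_smul C hθ.continuous.aestronglyMeasurable (.of_forall hC)
    rw [map_neg, ← ContinuousLinearMap.integral_comp_comm _ m1,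
      ← ContinuousLinearMap.integral_comp_comm _ m2] at h1
    simpa using h1

/-- U is Lipschitz on a compact convex set containing the graph of h, and the increments of (t, h t)
are at most those of the primitive of 1 + ‖h'‖, which is absolutely continuous. -/
theorem absolutelyContinuousOnInterval_comp (hq : 1 ≤ q) (hT : 0 < T) (hW : IsW1q q T h h')
    (hcont : ContinuousOn h (Icc 0 T)) {U : ℝ × Plane → ℝ} (hU : ContDiff ℝ 1 U) :
    AbsolutelyContinuousOnInterval (fun t => U (t, h t)) 0 T := by
  have hI : IntegrableOn h' (Ioo 0 T) := hW.memLp_deriv.integrable hq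
  have hIi : IntervalIntegrable h' volume 0 T := by
    rwa [intervalIntegrable_iff_integrableOn_Ioo_of_le hT.le]
  have hIn : IntervalIntegrable (fun t => 1 + ‖h' t‖) volume 0 T :=
    intervalIntegrable_const.add hIi.norm
  obtain ⟨r, hr⟩ := (isCompact_Icc.image_of_continuousOn hcont).isBounded.subset_closedBall 0
  have hconv : Convex ℝ (Icc 0 T ×ˢ Metric.closedBall (0 : Plane) r) :=
    (convex_Icc 0 T).prod (convex_closedBall 0 r)
  have hcpt : IsCompact (Icc 0 T ×ˢ Metric.closedBall (0 : Plane) r) :=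
    isCompact_Icc.prod (isCompact_closedBall 0 r)
  obtain ⟨C, hC⟩ := hU.contDiffOn.exists_lipschitzOnWith (by simp) hconv hcpt
  have hmono : ∀ s ∈ Icc 0 T, ∀ t ∈ Icc 0 T, s ≤ t → dist (U (s, h s)) (U (t, h t))
      ≤ C * dist (∫ τ in 0..s, (1 + ‖h' τ‖)) (∫ τ in 0..t, (1 + ‖h' τ‖)) := by
    intro s hs t ht hst
    have hsub : ∀ {f : ℝ → ℝ}, IntervalIntegrable f volume 0 T → ∀ x ∈ Icc 0 T,
        IntervalIntegrable f volume 0 x := fun hf x hx =>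
      hf.mono_set (by rw [uIcc_of_le hx.1, uIcc_of_le hT.le]; exact Icc_subset_Icc_right hx.2)
    have hsub' : ∀ x ∈ Icc 0 T, IntervalIntegrable h' volume 0 x := fun x hx =>
      hIi.mono_set (by rw [uIcc_of_le hx.1, uIcc_of_le hT.le]; exact Icc_subset_Icc_right hx.2)
    refine (hC.dist_le_mul _ ⟨hs, hr (mem_image_of_mem _ hs)⟩ _
      ⟨ht, hr (mem_image_of_mem _ ht)⟩).trans (mul_le_mul_of_nonneg_left ?_ C.2)
    have h2 : ∫ τ in s..t, (1 + ‖h' τ‖) = (t - s) + ∫ τ in s..t, ‖h' τ‖ := by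
      rw [intervalIntegral.integral_add intervalIntegrable_const
        ((hsub' s hs).symm.trans (hsub' t ht)).norm]
      simp
    have h3 : 0 ≤ ∫ τ in s..t, ‖h' τ‖ :=
      intervalIntegral.integral_nonneg hst fun _ _ => norm_nonneg _
    rw [dist_comm (∫ τ in 0..s, _), Real.dist_eq,
      intervalIntegral.integral_interval_sub_left (hsub hIn t ht) (hsub hIn s hs), h2,
      abs_of_nonneg (by linarith)]
    rw [Prod.dist_eq, max_le_iff]
    constructor
    · rw [dist_comm, Real.dist_eq, abs_of_nonneg (by linarith)]
      linarith
    · rw [dist_comm, dist_eq_norm, eq_add_integral hq hT hW hcont t ht,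
        eq_add_integral hq hT hW hcont s hs, add_sub_add_left_eq_sub,
        intervalIntegral.integral_interval_sub_left (hsub' t ht) (hsub' s hs)]
      have := intervalIntegral.norm_integral_le_integral_norm (f := h') (μ := volume) hst
      linarith
  refine (hIn.absolutelyContinuousOnInterval_intervalIntegral left_mem_uIcc).of_dist_le
    (C := C) fun s hs t ht => ?_
  rw [uIcc_of_le hT.le] at hs ht
  rcases le_total s t with hst | hst
  · exact hmono s hs t ht hst
  · rw [dist_comm, dist_comm (∫ τ in 0..s, _)]
    exact hmono t ht s hs hst

theorem ae_hasDerivAt (hq : 1 ≤ q) (hT : 0 < T) (hW : IsW1q q T h h')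
    (hcont : ContinuousOn h (Icc 0 T)) : ∀ᵐ t, t ∈ Ioo 0 T → HasDerivAt h (h' t) t := by
  have hI : IntegrableOn h' (Ioo 0 T) := hW.memLp_deriv.integrable hq
  have hIi : IntervalIntegrable h' volume 0 T := by
    rwa [intervalIntegrable_iff_integrableOn_Ioo_of_le hT.le]
  filter_upwards [hIi.ae_hasDerivAt_integral] with t ht htI
  have ht' : t ∈ uIcc 0 T := by
    rw [uIcc_of_le hT.le]
    exact Ioo_subset_Icc_self htI
  refine ((ht ht' 0 left_mem_uIcc).const_add (h 0)).congr_of_eventuallyEq ?_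
  filter_upwards [isOpen_Ioo.mem_nhds htI] with s hs
  exact eq_add_integral hq hT hW hcont s (Ioo_subset_Icc_self hs)

/-- Integration by parts for absolutely continuous functions. The boundary terms vanish with θ, and
the classical chain rule holds at almost every t, where h has derivative h' t. -/
theorem integral_deriv_mul_comp (hq : 1 ≤ q) (hT : 0 < T) (hW : IsW1q q T h h')
    (hcont : ContinuousOn h (Icc 0 T)) {U : ℝ × Plane → ℝ} (hU : ContDiff ℝ 1 U)
    {θ : ℝ → ℝ} (hθ : ContDiff ℝ ∞ θ) (hθs : tsupport θ ⊆ Ioo 0 T) :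
    ∫ t in Ioo 0 T, deriv θ t * U (t, h t)
      = - ∫ t in Ioo 0 T, θ t * fderiv ℝ U (t, h t) (1, h' t) := by
  have hz : ∀ t, t ∉ Ioo 0 T → θ t = 0 := fun t ht =>
    image_eq_zero_of_notMem_tsupport fun h => ht (hθs h)
  have hparts := (((hθ.of_le (by norm_cast)).contDiffOn :
    ContDiffOn ℝ 1 θ (uIcc 0 T)).absolutelyContinuousOnInterval).integral_mul_deriv_eq_deriv_mul
      (absolutelyContinuousOnInterval_comp hq hT hW hcont hU)
  rw [hz 0 (by simp), hz T (by simp), intervalIntegral.integral_of_le hT.le,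
    intervalIntegral.integral_of_le hT.le, integral_Ioc_eq_integral_Ioo,
    integral_Ioc_eq_integral_Ioo] at hparts
  have hcongr : ∫ t in Ioo 0 T, θ t * deriv (fun t => U (t, h t)) t
      = ∫ t in Ioo 0 T, θ t * fderiv ℝ U (t, h t) (1, h' t) := by
    refine setIntegral_congr_ae measurableSet_Ioo ?_
    filter_upwards [ae_hasDerivAt hq hT hW hcont] with t ht htI
    have h1 : HasDerivAt (fun t => (t, h t)) (1, h' t) t := (hasDerivAt_id t).prodMk (ht htI)
    have h2 := ((hU.differentiable (by simp)) (t, h t)).hasFDerivAt.comp_hasDerivAt t h1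
    rw [← h2.deriv]
    rfl
  rw [← hcongr, hparts]
  ring

variable {X : Type*} [NormedAddCommGroup X] [NormedSpace ℝ X] [CompleteSpace X]

/-- The chain rule for the composition of a `C¹` map with the graph of a `W^{1,q}` curve. -/
theorem comp_contDiff (hq : 1 ≤ q) (hT : 0 < T) (hW : IsW1q q T h h')
    (hcont : ContinuousOn h (Icc 0 T)) {U : ℝ × Plane → X} (hU : ContDiff ℝ 1 U) :
    IsW1q q T (fun t => U (t, h t)) fun t => fderiv ℝ U (t, h t) (1, h' t) := by
  have hcu : ContinuousOn (fun t => U (t, h t)) (Icc 0 T) :=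
    hU.continuous.comp_continuousOn (continuousOn_id.prodMk hcont)
  have hcD : ContinuousOn (fun t => fderiv ℝ U (t, h t)) (Icc 0 T) :=
    (hU.continuous_fderiv (by simp)).comp_continuousOn (continuousOn_id.prodMk hcont)
  obtain ⟨C₀, hC₀⟩ := isCompact_Icc.exists_bound_of_continuousOn hcu
  obtain ⟨C₁, hC₁⟩ := isCompact_Icc.exists_bound_of_continuousOn hcD
  have hu : MemLp (fun t => U (t, h t)) q (timeMeasure T) := by
    refine MemLp.of_bound ((hcu.mono Ioo_subset_Icc_self).aestronglyMeasurable measurableSet_Ioo)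
      C₀ ?_
    filter_upwards [ae_restrict_mem measurableSet_Ioo] with t ht
    exact hC₀ t (Ioo_subset_Icc_self ht)
  have hv : MemLp (fun t => fderiv ℝ U (t, h t) (1, h' t)) q (timeMeasure T) := by
    have hg : MemLp (fun t => 1 + ‖h' t‖) q (timeMeasure T) :=
      MemLp.add (f := fun _ => (1 : ℝ)) (memLp_const 1) hW.memLp_deriv.norm
    have m1 : AEStronglyMeasurable (fun t => fderiv ℝ U (t, h t)) (timeMeasure T) :=
      (hcD.mono Ioo_subset_Icc_self).aestronglyMeasurable measurableSet_Ioo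
    have m2 : AEStronglyMeasurable (fun t => ((1 : ℝ), h' t)) (timeMeasure T) :=
      aestronglyMeasurable_const.prodMk hW.memLp_deriv.aestronglyMeasurable
    have hcont2 : Continuous fun z : (ℝ × Plane →L[ℝ] X) × (ℝ × Plane) => z.1 z.2 :=
      continuous_fst.clm_apply continuous_snd
    refine hg.of_le_mul (c := C₁) (hcont2.comp_aestronglyMeasurable (m1.prodMk m2)) ?_
    filter_upwards [ae_restrict_mem measurableSet_Ioo] with t ht
    have h1 := hC₁ t (Ioo_subset_Icc_self ht)
    have h2 : ‖((1 : ℝ), h' t)‖ ≤ ‖1 + ‖h' t‖‖ := by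
      rw [Prod.norm_mk, Real.norm_of_nonneg (by positivity : 0 ≤ 1 + ‖h' t‖), norm_one]
      exact max_le (by linarith [norm_nonneg (h' t)]) (by linarith)
    exact ((fderiv ℝ U (t, h t)).le_opNorm _).trans
      (mul_le_mul h1 h2 (norm_nonneg _) ((norm_nonneg _).trans h1))
  refine ⟨hu, hv, fun θ hθ hθc hθs => ?_⟩
  have hθ' : Continuous (deriv θ) := hθ.continuous_deriv (by simp)
  have m1 : IntegrableOn (fun t => deriv θ t • U (t, h t)) (Ioo 0 T) :=
    ((hθ'.continuousOn.smul hcu).integrableOn_Icc).mono_set Ioo_subset_Icc_self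
  obtain ⟨C, hC⟩ := hθc.exists_bound_of_continuous hθ.continuous
  have m2 : IntegrableOn (fun t => θ t • fderiv ℝ U (t, h t) (1, h' t)) (Ioo 0 T) :=
    (hv.integrable hq).bdd_smul C hθ.continuous.aestronglyMeasurable (.of_forall hC)
  -- Continuous linear functionals reduce the identity in X to the scalar case ℓ ∘ U.
  refine (SeparatingDual.eq_iff_forall_dual_eq (R := ℝ)).2 fun ℓ => ?_
  rw [map_neg, ← ContinuousLinearMap.integral_comp_comm _ m1,
    ← ContinuousLinearMap.integral_comp_comm _ m2]
  have key := integral_deriv_mul_comp hq hT hW hcont (ℓ.contDiff.comp hU) hθ hθs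
  have hfd : ∀ p, fderiv ℝ (ℓ ∘ U) p = ℓ.comp (fderiv ℝ U p) := fun p =>
    (ℓ.hasFDerivAt.comp p ((hU.differentiable (by simp)) p).hasFDerivAt).fderiv
  simpa [hfd] using key

end IsW1q

/-! ### Weak convergence -/

section WeakConvergence

variable {X : Type*} [NormedAddCommGroup X] {α : Type*} [MeasurableSpace α] {μ : Measure α}

section Inclusion

variable [NormedSpace ℝ X] [IsFiniteMeasure μ]

/-- The inclusion of `L^p` into `L^q` for a finite measure and `q ≤ p`. -/
def lpInclusion {p q : ℝ≥0∞} [Fact (1 ≤ p)] [Fact (1 ≤ q)] (hqp : q ≤ p) :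
    Lp X p μ →L[ℝ] Lp X q μ :=
  LinearMap.mkContinuous
    { toFun := fun f => ((Lp.memLp f).mono_exponent hqp).toLp f
      map_add' := fun f g => by
        rw [← MemLp.toLp_add]
        exact MemLp.toLp_congr _ _ (Lp.coeFn_add f g)
      map_smul' := fun c f => by
        rw [RingHom.id_apply, ← MemLp.toLp_const_smul]
        exact MemLp.toLp_congr _ _ (Lp.coeFn_smul c f) }
    (μ univ ^ (1 / q.toReal - 1 / p.toReal)).toReal fun f => by
      -- A nonnegative exponent keeps the Hölder constant finite. For p = ∞ the term 1 / p.toReal is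
      -- 1 / 0 = 0, the intended value.
      have h0 : 0 ≤ 1 / q.toReal - 1 / p.toReal := by
        have hq : 1 ≤ q := Fact.out
        rcases eq_or_ne p ⊤ with rfl | hp
        · simp
        · rw [sub_nonneg]
          exact one_div_le_one_div_of_le
            (ENNReal.toReal_pos (by positivity) (hqp.trans_lt hp.lt_top).ne)
            (ENNReal.toReal_mono hp hqp)
      rw [LinearMap.coe_mk, AddHom.coe_mk, Lp.norm_toLp, mul_comm, Lp.norm_def,
        ← ENNReal.toReal_mul]
      exact ENNReal.toReal_mono (ENNReal.mul_ne_top (Lp.eLpNorm_ne_top f)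
        (ENNReal.rpow_ne_top_of_nonneg h0 (measure_ne_top _ _)))
        (eLpNorm_le_eLpNorm_mul_rpow_measure_univ hqp (Lp.aestronglyMeasurable f))

theorem lpInclusion_toLp {p q : ℝ≥0∞} [Fact (1 ≤ p)] [Fact (1 ≤ q)] (hqp : q ≤ p) {f : α → X}
    (hf : MemLp f p μ) : lpInclusion hqp (hf.toLp f) = (hf.mono_exponent hqp).toLp f :=
  MemLp.toLp_congr ((Lp.memLp _).mono_exponent hqp) _ hf.coeFn_toLp

end Inclusion

variable [InnerProductSpace ℝ X] [CompleteSpace X] {ι : Type*} {l : Filter ι}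
  [l.IsCountablyGenerated]

/-- A dominated sequence in `L^q`, `q ≤ 2`, that converges weakly at almost every point converges
weakly in `L^q`. -/
theorem tendsto_strongDual_of_tendsto_inner [IsFiniteMeasure μ] {q : ℝ≥0∞} [Fact (1 ≤ q)]
    (hq : q ≤ 2) {u : ι → α → X} {u₀ : α → X} {m : α → ℝ} (hm : MemLp m q μ)
    (hu : ∀ i, MemLp (u i) q μ) (hu₀ : MemLp u₀ q μ)
    (hb : ∀ᶠ i in l, ∀ᵐ t ∂μ, ‖u i t‖ ≤ m t) (hb₀ : ∀ᵐ t ∂μ, ‖u₀ t‖ ≤ m t)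
    (hw : ∀ᵐ t ∂μ, ∀ w : X, Tendsto (fun i => inner ℝ w (u i t)) l (𝓝 (inner ℝ w (u₀ t))))
    (Λ : StrongDual ℝ (Lp X q μ)) :
    Tendsto (fun i => Λ ((hu i).toLp (u i))) l (𝓝 (Λ (hu₀.toLp u₀))) := by
  rw [Metric.tendsto_nhds]
  intro ε hε
  -- Three errors of size at most ε/4 are added at the end; the + 1 covers Λ = 0.
  set ε' := ε / (4 * (‖Λ‖ + 1)) with hε'
  have hε'0 : 0 < ε' := by positivity
  have hΛε : ‖Λ‖ * ε' ≤ ε / 4 := by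
    rw [hε', mul_div_assoc', div_le_div_iff₀ (by positivity) (by norm_num)]
    nlinarith [norm_nonneg Λ]
  set m' := hm.1.mk m with hm'
  have hmm' : m =ᵐ[μ] m' := hm.1.ae_eq_mk
  have hsm : StronglyMeasurable m' := hm.1.stronglyMeasurable_mk
  -- The majorant is below M off the set A, and its restriction to A has L^q norm at most ε'.
  obtain ⟨M, hM, hMle⟩ := ((memLp_congr_ae hmm').1 hm).eLpNorm_indicator_norm_ge_pos_le hsm hε'0
  set A : Set α := {x | M ≤ ‖m' x‖₊} with hA
  have hAm : MeasurableSet A := measurableSet_le measurable_const hsm.measurable.norm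
  -- The truncated functions are bounded, hence in L², where Λ is represented by r through Riesz.
  -- This uses q ≤ 2 and makes a description of the dual of L^q unnecessary.
  set r : Lp X 2 μ := (InnerProductSpace.toDual ℝ (Lp X 2 μ)).symm (Λ.comp (lpInclusion hq))
  have hbd : ∀ v : α → X, (∀ᵐ t ∂μ, ‖v t‖ ≤ m t) → ∀ᵐ t ∂μ, ‖Aᶜ.indicator v t‖ ≤ M := by
    intro v hv
    filter_upwards [hv, hmm'] with t h1 h2
    by_cases ht : t ∈ A
    · rw [indicator_of_notMem (by simpa using ht), norm_zero]
      exact hM.le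
    · rw [indicator_of_mem ht]
      have h3 : ‖m' t‖ < M := not_le.1 ht
      exact h1.trans (h2 ▸ (le_abs_self _).trans h3.le)
  have split : ∀ (v : α → X) (hv : MemLp v q μ), (∀ᵐ t ∂μ, ‖v t‖ ≤ m t) →
      |Λ (hv.toLp v) - ∫ t, inner ℝ (r t) (Aᶜ.indicator v t) ∂μ| ≤ ε / 4 := by
    intro v hv hvm
    have h2 : MemLp (Aᶜ.indicator v) 2 μ :=
      MemLp.of_bound (hv.1.indicator hAm.compl) M (hbd v hvm)
    have h3 : ∫ t, inner ℝ (r t) (Aᶜ.indicator v t) ∂μ = Λ ((hv.indicator hAm.compl).toLp _) := by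
      have h4 : inner ℝ r (h2.toLp _) = Λ (lpInclusion hq (h2.toLp _)) :=
        InnerProductSpace.toDual_symm_apply
      rw [lpInclusion_toLp] at h4
      rw [← h4, L2.inner_def]
      refine integral_congr_ae ?_
      filter_upwards [h2.coeFn_toLp] with t ht
      rw [ht]
    rw [h3, ← map_sub, ← MemLp.toLp_sub]
    refine (Λ.le_opNorm _).trans ((mul_le_mul_of_nonneg_left ?_ (norm_nonneg _)).trans hΛε)
    rw [Lp.norm_toLp]
    refine ENNReal.toReal_le_of_le_ofReal hε'0.le (le_trans (eLpNorm_mono_ae ?_) hMle)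
    filter_upwards [hvm, hmm'] with t h1 h2
    by_cases ht : t ∈ A
    · rw [Pi.sub_apply, indicator_of_notMem (by simpa using ht), sub_zero, indicator_of_mem ht]
      exact h1.trans (h2 ▸ le_abs_self _)
    · rw [Pi.sub_apply, indicator_of_mem ht, sub_self, norm_zero]
      exact norm_nonneg _
  have hr : MemLp r 1 μ := (Lp.memLp r).mono_exponent (by norm_num)
  have hlim : Tendsto (fun i => ∫ t, inner ℝ (r t) (Aᶜ.indicator (u i) t) ∂μ) l
      (𝓝 (∫ t, inner ℝ (r t) (Aᶜ.indicator u₀ t) ∂μ)) := by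
    refine tendsto_integral_filter_of_dominated_convergence (fun t => ‖r t‖ * M)
      (.of_forall fun i => (Lp.aestronglyMeasurable r).inner ((hu i).1.indicator hAm.compl)) ?_
      ((memLp_one_iff_integrable.1 hr).norm.mul_const M) ?_
    · filter_upwards [hb] with i hi
      filter_upwards [hbd _ hi] with t ht
      exact (norm_inner_le_norm _ _).trans (mul_le_mul_of_nonneg_left ht (norm_nonneg _))
    · filter_upwards [hw] with t ht
      by_cases htA : t ∈ A
      · simp only [indicator_of_notMem (show t ∉ Aᶜ by simpa using htA)]
        exact tendsto_const_nhds
      · simpa [indicator_of_mem (show t ∈ Aᶜ from htA)] using ht (r t)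
  have h0 := split u₀ hu₀ hb₀
  filter_upwards [Metric.tendsto_nhds.1 hlim (ε / 4) (by positivity), hb] with i h1 h2
  have h3 := split (u i) (hu i) h2
  rw [Real.dist_eq] at h1 ⊢
  rw [abs_le] at h0 h3
  rw [abs_lt] at h1 ⊢
  constructor <;> linarith [h0.1, h0.2, h1.1, h1.2, h3.1, h3.2]

theorem weaklyTendstoLq_of_tendsto_inner {T : ℝ} {q : ℝ≥0∞} [Fact (1 ≤ q)]
    (hq : q ≤ 2) {u : ι → ℝ → X} {u₀ : ℝ → X} {m : ℝ → ℝ} (hm : MemLp m q (timeMeasure T))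
    (hu : ∀ᶠ i in l, MemLp (u i) q (timeMeasure T)) (hu₀ : MemLp u₀ q (timeMeasure T))
    (hb : ∀ᶠ i in l, ∀ᵐ t ∂timeMeasure T, ‖u i t‖ ≤ m t)
    (hb₀ : ∀ᵐ t ∂timeMeasure T, ‖u₀ t‖ ≤ m t)
    (hw : ∀ᵐ t ∂timeMeasure T, ∀ w : X,
      Tendsto (fun i => inner ℝ w (u i t)) l (𝓝 (inner ℝ w (u₀ t)))) :
    WeaklyTendstoLq q T l u u₀ := by
  classical
  -- The indices at which u i is not in L^q get the value 0; eventually there are none.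
  set v : ι → ℝ → X := fun i => if MemLp (u i) q (timeMeasure T) then u i else 0 with hv
  have hvm : ∀ i, MemLp (v i) q (timeMeasure T) := by
    intro i
    by_cases h : MemLp (u i) q (timeMeasure T)
    · simp [hv, h]
    · simp [hv, h]
  have hvu : ∀ᶠ i in l, v i = u i := hu.mono fun i hi => if_pos hi
  refine ⟨fun i => (hvm i).toLp _, hu₀.toLp _, ?_, hu₀.coeFn_toLp, fun Λ =>
    tendsto_strongDual_of_tendsto_inner hq hm hvm hu₀ ?_ hb₀ ?_ Λ⟩
  · filter_upwards [hvu] with i hi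
    rw [← hi]
    exact (hvm i).coeFn_toLp
  · filter_upwards [hvu, hb] with i hi hbi
    rwa [hi]
  · filter_upwards [hw] with t ht w
    refine (ht w).congr' ?_
    filter_upwards [hvu] with i hi
    rw [hi]

/-- By Riesz each w t is an inner product, so the integrands converge at almost every t, and ‖w t‖ *
C is an integrable majorant. -/
theorem weakStarTendstoLinfty_of_tendsto_inner {T : ℝ} {u : ι → ℝ → X} {u₀ : ℝ → X} {C : ℝ}
    (hu : ∀ᶠ i in l, AEStronglyMeasurable (u i) (timeMeasure T))
    (hu₀ : MemLp u₀ ∞ (timeMeasure T))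
    (hb : ∀ᶠ i in l, ∀ᵐ t ∂timeMeasure T, ‖u i t‖ ≤ C)
    (hw : ∀ᵐ t ∂timeMeasure T, ∀ w : X,
      Tendsto (fun i => inner ℝ w (u i t)) l (𝓝 (inner ℝ w (u₀ t)))) :
    WeakStarTendstoLinfty T l u u₀ := by
  refine ⟨?_, hu₀, fun w hwi => ?_⟩
  · filter_upwards [hu, hb] with i h1 h2
    exact memLp_top_of_bound h1 C h2
  · have hc : Continuous fun z : StrongDual ℝ X × X => z.1 z.2 :=
      continuous_fst.clm_apply continuous_snd
    refine tendsto_integral_filter_of_dominated_convergence (fun t => ‖w t‖ * C) ?_ ?_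
      (hwi.norm.mul_const C) ?_
    · filter_upwards [hu] with i hi
      exact hc.comp_aestronglyMeasurable (hwi.1.prodMk hi)
    · filter_upwards [hb] with i hi
      filter_upwards [hi] with t ht
      exact ((w t).le_opNorm _).trans (mul_le_mul_of_nonneg_left ht (norm_nonneg _))
    · filter_upwards [hw] with t ht
      simpa only [InnerProductSpace.toDual_symm_apply] using
        ht ((InnerProductSpace.toDual ℝ X).symm (w t))

end WeakConvergence

/-- Bounded sequences of `L²` that concentrate at a point converge weakly to `0`. -/
theorem tendsto_inner_ofField_of_concentrating {ι : Type*} {l : Filter ι} {f : ι → Plane → Plane}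
    {r : ι → ℝ} {a : Plane} {C : ℝ} (hr : Tendsto r l (𝓝 0)) (hr0 : ∀ᶠ i in l, 0 ≤ r i)
    (hf : ∀ᶠ i in l, MemLp (f i) 2 (volume : Measure Plane))
    (hs : ∀ᶠ i in l, ∀ x ∉ Metric.closedBall a (r i), f i x = 0)
    (hb : ∀ᶠ i in l, ‖L2Field.ofField (f i)‖ ≤ C) (w : L2Field) :
    Tendsto (fun i => inner ℝ w (L2Field.ofField (f i))) l (𝓝 0) := by
  rw [Metric.tendsto_nhds]
  intro ε hε
  -- Absolute continuity of the integral of |w|²: w is small in L² on every set of area at most δ,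
  -- in particular on the discs once their radius is small. Cauchy–Schwarz on the disc then
  -- concludes.
  obtain ⟨δ, hδ, hδw⟩ := (Lp.memLp w).eLpNorm_indicator_le (by norm_num) (by norm_num)
    (show 0 < ε / (2 * (|C| + 1)) by positivity)
  have hvol : Tendsto (fun i => ENNReal.ofReal (r i ^ Module.finrank ℝ Plane)
      * volume (Metric.ball (0 : Plane) 1)) l (𝓝 0) := by
    have h1 : Tendsto (fun i => ENNReal.ofReal (r i ^ Module.finrank ℝ Plane)) l (𝓝 0) := by
      have := ENNReal.tendsto_ofReal (hr.pow (Module.finrank ℝ Plane))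
      simpa using this
    have := ENNReal.Tendsto.mul_const (b := volume (Metric.ball (0 : Plane) 1)) h1
      (Or.inr measure_ball_lt_top.ne)
    simpa using this
  filter_upwards [hr0, hf, hs, hb, hvol.eventually_le_const (u := ENNReal.ofReal δ) (by simpa)]
    with i h0 hfi hsi hbi hvi
  rw [← Measure.addHaar_closedBall volume a h0] at hvi
  have hw := hδw _ Metric.isClosed_closedBall.measurableSet hvi
  have hwm : MemLp ((Metric.closedBall a (r i)).indicator w) 2 (volume : Measure Plane) :=
    (Lp.memLp w).indicator Metric.isClosed_closedBall.measurableSet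
  have heq : inner ℝ w (L2Field.ofField (f i)) = inner ℝ (hwm.toLp _) (L2Field.ofField (f i)) := by
    rw [L2.inner_def, L2.inner_def]
    refine integral_congr_ae ?_
    filter_upwards [hwm.coeFn_toLp, L2Field.coeFn_ofField hfi] with x h1 h2
    rw [h1, h2]
    by_cases hx : x ∈ Metric.closedBall a (r i)
    · rw [indicator_of_mem hx]
    · rw [hsi x hx, inner_zero_right, inner_zero_right]
  rw [dist_zero_right, heq]
  have h1 : ‖hwm.toLp _‖ ≤ ε / (2 * (|C| + 1)) := by
    rw [Lp.norm_toLp]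
    exact ENNReal.toReal_le_of_le_ofReal (by positivity) hw
  refine (norm_inner_le_norm _ _).trans_lt ((mul_le_mul h1 (hbi.trans (le_abs_self C))
    (norm_nonneg _) (by positivity)).trans_lt ?_)
  rw [div_mul_eq_mul_div, div_lt_iff₀ (by positivity)]
  nlinarith [abs_nonneg C]

/-! ### Integration along rays and stream functions -/

section Ray

universe u v

variable {E : Type u} [NormedAddCommGroup E] [NormedSpace ℝ E] {V : Type v} [NormedAddCommGroup V]
  {e : E} {f : E → V}

/-- A compactly supported function vanishes at the far end of all rays from a ball. -/
theorem exists_ray_eq_zero (he : e ≠ 0) (hc : HasCompactSupport f) (r : ℝ) :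
    ∃ L : ℝ, ∀ p : E, ‖p‖ ≤ r → ∀ s, L < s → f (p - s • e) = 0 := by
  obtain ⟨ρ, hρ⟩ := hc.isCompact.isBounded.subset_closedBall 0
  -- Beyond (r + ρ)/‖e‖ the ray has left the ball of radius ρ that contains the support; the maximum
  -- with 0 makes s positive.
  refine ⟨max ((r + ρ) / ‖e‖) 0, fun p hp s hs => ?_⟩
  have he' : 0 < ‖e‖ := norm_pos_iff.2 he
  have hs0 : 0 < s := (le_max_right _ _).trans_lt hs
  have h1 : r + ρ < s * ‖e‖ := (div_lt_iff₀ he').1 ((le_max_left _ _).trans_lt hs)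
  refine image_eq_zero_of_notMem_tsupport fun h => ?_
  have h2 : ‖p - s • e‖ ≤ ρ := by simpa using hρ h
  have h3 : ‖s • e‖ ≤ ‖p‖ + ‖p - s • e‖ := by
    have := norm_sub_le p (p - s • e)
    rwa [sub_sub_cancel] at this
  rw [norm_smul, Real.norm_of_nonneg hs0.le] at h3
  linarith

theorem integrableOn_ray (he : e ≠ 0) (hf : Continuous f) (hc : HasCompactSupport f) (p : E) :
    IntegrableOn (fun s : ℝ => f (p - s • e)) (Ioi 0) := by
  obtain ⟨L, hL⟩ := exists_ray_eq_zero he hc ‖p‖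
  have h1 : IntegrableOn (fun s : ℝ => f (p - s • e)) (Icc 0 L) :=
    (by fun_prop : Continuous fun s : ℝ => f (p - s • e)).integrableOn_Icc
  refine h1.of_forall_sdiff_eq_zero measurableSet_Ioi fun s hs => hL p le_rfl s ?_
  by_contra h
  exact hs.2 ⟨le_of_lt hs.1, not_lt.1 h⟩

variable [NormedSpace ℝ V]

/-- The integral of `f` over the ray from `p` in the direction `-e`. -/
def rayIntegral (e : E) (f : E → V) (p : E) : V := ∫ s in Ioi (0 : ℝ), f (p - s • e)

theorem hasFDerivAt_rayIntegral (he : e ≠ 0) (hf : ContDiff ℝ 1 f) (hc : HasCompactSupport f)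
    (p₀ : E) : HasFDerivAt (rayIntegral e f) (rayIntegral e (fderiv ℝ f) p₀) p₀ := by
  have hfc : Continuous (fderiv ℝ f) := hf.continuous_fderiv (by simp)
  obtain ⟨C, hC⟩ := (hc.fderiv ℝ).exists_bound_of_continuous hfc
  -- The radius ‖p₀‖ + 1 gives one L for the whole unit ball about p₀, hence a majorant independent
  -- of p.
  obtain ⟨L, hL⟩ := exists_ray_eq_zero he (hc.fderiv ℝ) (‖p₀‖ + 1)
  refine hasFDerivAt_integral_of_dominated_of_fderiv_le (μ := volume.restrict (Ioi (0 : ℝ)))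
    (F := fun p (s : ℝ) => f (p - s • e)) (F' := fun p (s : ℝ) => fderiv ℝ f (p - s • e))
    (bound := (Iic L).indicator fun _ => C) (Metric.ball_mem_nhds p₀ zero_lt_one)
    (.of_forall fun p => ?_) (integrableOn_ray he hf.continuous hc p₀) ?_ ?_ ?_ ?_
  · exact (integrableOn_ray he hf.continuous hc p).aestronglyMeasurable
  · exact (integrableOn_ray he hfc (hc.fderiv ℝ) p₀).aestronglyMeasurable
  · refine .of_forall fun s p hp => ?_
    by_cases hs : s ≤ L
    · rw [indicator_of_mem (show s ∈ Iic L from hs)]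
      exact hC _
    · have : ‖p‖ ≤ ‖p₀‖ + 1 := by
        have h1 := norm_le_norm_add_norm_sub' p p₀
        rw [Metric.mem_ball, dist_eq_norm] at hp
        linarith
      rw [hL p this s (not_le.1 hs), norm_zero]
      exact indicator_nonneg (fun _ _ => (norm_nonneg _).trans (hC 0)) s
  · rw [integrable_indicator_iff measurableSet_Iic, IntegrableOn, Measure.restrict_restrict
      measurableSet_Iic, inter_comm, Ioi_inter_Iic]
    exact integrableOn_const (by simp)
  · refine .of_forall fun s p _ => ?_
    exact ((hf.differentiable (by simp)) (p - s • e)).hasFDerivAt.comp p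
      ((hasFDerivAt_id p).sub_const _)

theorem fderiv_rayIntegral_apply (he : e ≠ 0) (hf : ContDiff ℝ 1 f)
    (hc : HasCompactSupport f) (p v : E) :
    fderiv ℝ (rayIntegral e f) p v = rayIntegral e (fun z => fderiv ℝ f z v) p := by
  rw [(hasFDerivAt_rayIntegral he hf hc p).fderiv, rayIntegral,
    ContinuousLinearMap.integral_apply
      (integrableOn_ray he (hf.continuous_fderiv (by simp)) (hc.fderiv ℝ) p)]
  rfl

/-- Integration of the derivative in the direction `e` along a ray. -/
theorem rayIntegral_fderiv_self [CompleteSpace V] (he : e ≠ 0) (hf : ContDiff ℝ 1 f)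
    (hc : HasCompactSupport f) (p : E) : rayIntegral e (fun z => fderiv ℝ f z e) p = f p := by
  have hd : ∀ s : ℝ, HasDerivAt (fun s : ℝ => -f (p - s • e)) (fderiv ℝ f (p - s • e) e) s := by
    intro s
    have h1 : HasDerivAt (fun s : ℝ => p - s • e) (-e) s := by
      simpa using ((hasDerivAt_id s).smul_const e).const_sub p
    have h2 := (((hf.differentiable (by simp)) (p - s • e)).hasFDerivAt.comp_hasDerivAt s h1).neg
    rwa [map_neg, neg_neg] at h2
  obtain ⟨L, hL⟩ := exists_ray_eq_zero he hc ‖p‖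
  have hlim : Tendsto (fun s : ℝ => -f (p - s • e)) atTop (𝓝 0) := by
    refine tendsto_const_nhds.congr' ?_
    filter_upwards [eventually_gt_atTop L] with s hs
    rw [hL p le_rfl s hs, neg_zero]
  have := integral_Ioi_of_hasDerivAt_of_tendsto (a := 0) (hd 0).continuousAt.continuousWithinAt
    (fun s _ => hd s) (integrableOn_ray he ((hf.continuous_fderiv (by simp)).clm_apply
      continuous_const) (hc.fderiv_apply (𝕜 := ℝ) e) p) hlim
  rw [rayIntegral, this]
  simp

/-- The derivative of a ray integral is the ray integral of the derivative, so the induction runs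
over all targets V at once. E and V share a universe so that the next target, the space of linear
maps from E to V, stays in it. -/
theorem contDiff_rayIntegral_nat {E : Type u} [NormedAddCommGroup E] [NormedSpace ℝ E] {e : E}
    (he : e ≠ 0) (n : ℕ) : ∀ {V : Type u} [NormedAddCommGroup V] [NormedSpace ℝ V] {f : E → V},
      ContDiff ℝ ∞ f → HasCompactSupport f → ContDiff ℝ n (rayIntegral e f) := by
  induction n with
  | zero =>
    intro V _ _ f hf hc
    exact contDiff_zero.2 (continuous_iff_continuousAt.2 fun p =>
      (hasFDerivAt_rayIntegral he (hf.of_le (by norm_cast)) hc p).continuousAt)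
  | succ n ih =>
    intro V _ _ f hf hc
    have h := fun p => hasFDerivAt_rayIntegral he (hf.of_le (by norm_cast)) hc p
    have h' : fderiv ℝ (rayIntegral e f) = rayIntegral e (fderiv ℝ f) :=
      funext fun p => (h p).fderiv
    refine contDiff_succ_iff_fderiv.2 ⟨fun p => (h p).differentiableAt,
      fun h => absurd h (WithTop.natCast_ne_top n), ?_⟩
    rw [h']
    exact ih (hf.fderiv_right (m := ∞) (by simp)) (hc.fderiv ℝ)

theorem contDiff_rayIntegral {E V : Type u} [NormedAddCommGroup E] [NormedSpace ℝ E]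
    [NormedAddCommGroup V] [NormedSpace ℝ V] {e : E} {f : E → V} (he : e ≠ 0)
    (hf : ContDiff ℝ ∞ f) (hc : HasCompactSupport f) : ContDiff ℝ ∞ (rayIntegral e f) :=
  contDiff_infty.2 fun n => contDiff_rayIntegral_nat he n hf hc

end Ray

/-! ### Stream functions -/

/-- The space-time direction of the second coordinate axis of the plane. -/
abbrev streamDir : ℝ × Plane := (0, planeBasis 1)

theorem streamDir_ne_zero : streamDir ≠ 0 := by
  intro h
  have h1 := congrArg (fun z : ℝ × Plane => z.2 1) h
  simp at h1

/-- The divergence in the space variables of a time dependent field of the plane. -/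
def spaceDiv (f : ℝ × Plane → Plane) (z : ℝ × Plane) : ℝ :=
  ∑ i : Fin 2, fderiv ℝ f z (0, planeBasis i) i

/-- The stream function of a compactly supported divergence free field. -/
def streamFunction (f : ℝ × Plane → Plane) (z : ℝ × Plane) : ℝ :=
  -rayIntegral streamDir (fun z => f z 0) z

section StreamFunction

variable {f : ℝ × Plane → Plane}

theorem contDiff_coord (hf : ContDiff ℝ ∞ f) (i : Fin 2) : ContDiff ℝ ∞ fun z => f z i :=
  (EuclideanSpace.proj (𝕜 := ℝ) i).contDiff.comp hf

theorem hasCompactSupport_coord (hc : HasCompactSupport f) (i : Fin 2) :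
    HasCompactSupport fun z => f z i :=
  hc.comp_left (g := fun y : Plane => y i) rfl

theorem fderiv_coord_apply (hf : ContDiff ℝ ∞ f) (i : Fin 2) (z v : ℝ × Plane) :
    fderiv ℝ (fun z => f z i) z v = fderiv ℝ f z v i := by
  have := ((EuclideanSpace.proj (𝕜 := ℝ) i).hasFDerivAt (x := f z)).comp z
    ((hf.differentiable (by simp)) z).hasFDerivAt
  have h2 : fderiv ℝ (fun z => f z i) z
      = (EuclideanSpace.proj (𝕜 := ℝ) i).comp (fderiv ℝ f z) := this.fderiv
  rw [h2]
  rfl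

theorem contDiff_streamFunction (hf : ContDiff ℝ ∞ f) (hc : HasCompactSupport f) :
    ContDiff ℝ ∞ (streamFunction f) :=
  (contDiff_rayIntegral streamDir_ne_zero (contDiff_coord hf 0) (hasCompactSupport_coord hc 0)).neg

theorem fderiv_streamFunction_apply (hf : ContDiff ℝ ∞ f) (hc : HasCompactSupport f)
    (z v : ℝ × Plane) : fderiv ℝ (streamFunction f) z v
      = -rayIntegral streamDir (fun z => fderiv ℝ f z v 0) z := by
  have h1 : ContDiff ℝ 1 fun z => f z 0 := (contDiff_coord hf 0).of_le (by norm_cast)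
  have h2 : fderiv ℝ (streamFunction f) z
      = -fderiv ℝ (rayIntegral streamDir fun z => f z 0) z := fderiv_neg
  rw [h2, neg_apply, fderiv_rayIntegral_apply streamDir_ne_zero h1
    (hasCompactSupport_coord hc 0)]
  simp_rw [fderiv_coord_apply hf]

theorem fderiv_streamFunction_one (hf : ContDiff ℝ ∞ f) (hc : HasCompactSupport f)
    (z : ℝ × Plane) : fderiv ℝ (streamFunction f) z (0, planeBasis 1) = -f z 0 := by
  have h1 : ContDiff ℝ 1 fun z => f z 0 := (contDiff_coord hf 0).of_le (by norm_cast)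
  rw [fderiv_streamFunction_apply hf hc]
  have := rayIntegral_fderiv_self streamDir_ne_zero h1 (hasCompactSupport_coord hc 0) z
  simp_rw [fderiv_coord_apply hf] at this
  rw [this]

/-- Under the integral, zero divergence replaces -∂₀f₀ by ∂₁f₁, whose ray integral is f₁. Together
with `fderiv_streamFunction_one` this says f = ∇⊥ψ. -/
theorem fderiv_streamFunction_zero (hf : ContDiff ℝ ∞ f) (hc : HasCompactSupport f)
    (hdiv : ∀ z, spaceDiv f z = 0) (z : ℝ × Plane) :
    fderiv ℝ (streamFunction f) z (0, planeBasis 0) = f z 1 := by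
  have h1 : ContDiff ℝ 1 fun z => f z 1 := (contDiff_coord hf 1).of_le (by norm_cast)
  rw [fderiv_streamFunction_apply hf hc]
  have := rayIntegral_fderiv_self streamDir_ne_zero h1 (hasCompactSupport_coord hc 1) z
  simp_rw [fderiv_coord_apply hf] at this
  rw [← this, rayIntegral, rayIntegral, ← integral_neg]
  congr 1
  funext s
  have h2 := hdiv (z - s • streamDir)
  rw [spaceDiv, Fin.sum_univ_two] at h2
  linarith

theorem Plane.eq_sum (y : Plane) : y = y 0 • planeBasis 0 + y 1 • planeBasis 1 := by
  ext i
  fin_cases i <;> simp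

theorem fderiv_streamFunction_space (hf : ContDiff ℝ ∞ f) (hc : HasCompactSupport f)
    (hdiv : ∀ z, spaceDiv f z = 0) (z : ℝ × Plane) (y : Plane) :
    fderiv ℝ (streamFunction f) z (0, y) = y 0 * f z 1 - y 1 * f z 0 := by
  have h : ((0 : ℝ), y) = y 0 • ((0 : ℝ), planeBasis 0) + y 1 • ((0 : ℝ), planeBasis 1) := by
    rw [Prod.smul_mk, Prod.smul_mk, Prod.mk_add_mk, ← Plane.eq_sum]
    simp
  rw [h, map_add, map_smul, map_smul, fderiv_streamFunction_zero hf hc hdiv,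
    fderiv_streamFunction_one hf hc, smul_eq_mul, smul_eq_mul]
  ring

/-- The rays stay in one time slice, so ψ vanishes at every time at which f does. -/
theorem streamFunction_eq_zero {t : ℝ} (h : ∀ x, f (t, x) = 0) (x : Plane) :
    streamFunction f (t, x) = 0 := by
  have : ∀ s : ℝ, f ((t, x) - s • streamDir) = 0 := by
    intro s
    rw [Prod.smul_mk, Prod.mk_sub_mk, smul_zero, sub_zero]
    exact h _
  simp only [streamFunction, rayIntegral, this]
  simp

theorem abs_coord_le_norm (y : Plane) (i : Fin 2) : |y i| ≤ ‖y‖ := PiLp.norm_apply_le y i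

/-- The integrand lives where |x₁ - s| ≤ ρ, an interval of length 2ρ. The time derivative is the
only derivative of ψ that is not read off from the components of f. -/
theorem abs_fderiv_streamFunction_time_le (hf : ContDiff ℝ ∞ f) (hc : HasCompactSupport f)
    {t M ρ : ℝ} (hM : ∀ x, ‖fderiv ℝ f (t, x)‖ ≤ M) (hρ : 0 ≤ ρ)
    (hsupp : ∀ x, ρ < ‖x‖ → fderiv ℝ f (t, x) = 0) (x : Plane) :
    |fderiv ℝ (streamFunction f) (t, x) (1, 0)| ≤ 2 * ρ * M := by
  have hM0 : 0 ≤ M := (norm_nonneg _).trans (hM 0)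
  rw [fderiv_streamFunction_apply hf hc, abs_neg]
  set S : Set ℝ := Icc (x 1 - ρ) (x 1 + ρ)
  have hint : Integrable (S.indicator fun _ => M) :=
    (integrable_indicator_iff measurableSet_Icc).2 (integrableOn_const (by simp))
  have hnn : 0 ≤ᵐ[volume] S.indicator fun _ => M :=
    .of_forall fun s => indicator_nonneg (fun _ _ => hM0) s
  have hb : ∀ s : ℝ, ‖fderiv ℝ f ((t, x) - s • streamDir) (1, 0) 0‖
      ≤ S.indicator (fun _ => M) s := by
    intro s
    rw [Prod.smul_mk, Prod.mk_sub_mk, smul_zero, sub_zero]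
    by_cases hs : s ∈ S
    · rw [indicator_of_mem hs]
      refine (abs_coord_le_norm _ 0).trans ((ContinuousLinearMap.le_opNorm _ _).trans ?_)
      rw [Prod.norm_mk, norm_one, norm_zero, max_eq_left zero_le_one, mul_one]
      exact hM _
    · rw [indicator_of_notMem hs, hsupp]
      · simp
      · refine lt_of_lt_of_le ?_ (abs_coord_le_norm _ 1)
        have h1 : (x - s • planeBasis 1) 1 = x 1 - s := by simp
        rw [h1]
        by_contra hle
        rw [not_lt, abs_le] at hle
        exact hs ⟨by linarith, by linarith⟩
  refine (norm_integral_le_of_norm_le hint.integrableOn (.of_forall hb)).trans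
    ((setIntegral_le_integral hint hnn).trans_eq ?_)
  rw [integral_indicator measurableSet_Icc, setIntegral_const, Real.volume_real_Icc_of_le
    (by linarith), smul_eq_mul]
  ring

end StreamFunction

/-! ### The cutoff near a moving point -/

/-- A smooth bump function of the plane, equal to `1` on the ball of radius `1 / 2` and supported
in the unit ball. -/
def planeBump : ContDiffBump (0 : Plane) := ⟨1 / 2, 1, by norm_num, by norm_num⟩

/-- The rotated gradient of `planeBump`. -/
def bumpCurl (y : Plane) : Plane :=
  (fderiv ℝ planeBump y (planeBasis 0)) • planeBasis 1
    - (fderiv ℝ planeBump y (planeBasis 1)) • planeBasis 0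

theorem contDiff_planeBump : ContDiff ℝ ∞ planeBump := planeBump.contDiff

theorem contDiff_fderiv_planeBump : ContDiff ℝ ∞ (fderiv ℝ planeBump) :=
  contDiff_planeBump.fderiv_right (by simp)

theorem contDiff_bumpCurl : ContDiff ℝ ∞ bumpCurl :=
  ((contDiff_fderiv_planeBump.clm_apply contDiff_const).smul contDiff_const).sub
    ((contDiff_fderiv_planeBump.clm_apply contDiff_const).smul contDiff_const)

theorem hasCompactSupport_bumpCurl : HasCompactSupport bumpCurl := by
  have h := planeBump.hasCompactSupport.fderiv ℝ
  exact h.comp_left (g := fun L : Plane →L[ℝ] ℝ => L (planeBasis 0) • planeBasis 1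
    - L (planeBasis 1) • planeBasis 0) (by simp)

theorem planeBump_eq_zero {y : Plane} (hy : 1 < ‖y‖) : planeBump y = 0 :=
  planeBump.zero_of_le_dist (by rw [dist_zero_right]; exact hy.le)

theorem bumpCurl_eq_zero {y : Plane} (hy : 1 < ‖y‖) : bumpCurl y = 0 := by
  have h : (planeBump : Plane → ℝ) =ᶠ[𝓝 y] fun _ => (0 : ℝ) := by
    filter_upwards [(isOpen_lt continuous_const continuous_norm).mem_nhds hy] with z hz
    exact planeBump_eq_zero hz
  simp [bumpCurl, h.fderiv_eq]

theorem planeBump_eq_one {y : Plane} (hy : ‖y‖ < 1 / 2) : planeBump y = 1 :=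
  planeBump.one_of_mem_closedBall (by
    rw [Metric.mem_closedBall, dist_zero_right]
    exact hy.le)

theorem bumpCurl_eq_zero_of_lt {y : Plane} (hy : ‖y‖ < 1 / 2) : bumpCurl y = 0 := by
  have h : (planeBump : Plane → ℝ) =ᶠ[𝓝 y] fun _ => (1 : ℝ) := by
    filter_upwards [(isOpen_lt continuous_norm continuous_const).mem_nhds hy] with z hz
    exact planeBump_eq_one hz
  simp [bumpCurl, h.fderiv_eq]

theorem bumpCurl_zero (y : Plane) : bumpCurl y 0 = -fderiv ℝ planeBump y (planeBasis 1) := by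
  simp [bumpCurl]

theorem bumpCurl_one (y : Plane) : bumpCurl y 1 = fderiv ℝ planeBump y (planeBasis 0) := by
  simp [bumpCurl]

theorem fderiv_bumpCurl_apply (y v : Plane) : fderiv ℝ bumpCurl y v
    = (fderiv ℝ (fderiv ℝ planeBump) y v (planeBasis 0)) • planeBasis 1
      - (fderiv ℝ (fderiv ℝ planeBump) y v (planeBasis 1)) • planeBasis 0 := by
  have h := (contDiff_fderiv_planeBump.differentiable (by simp) y).hasFDerivAt
  have h0 := (h.clm_apply (hasFDerivAt_const (planeBasis 0) y)).smul_const (planeBasis 1)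
  have h1 := (h.clm_apply (hasFDerivAt_const (planeBasis 1) y)).smul_const (planeBasis 0)
  have h2 : fderiv ℝ bumpCurl y = _ := (h0.sub h1).fderiv
  rw [h2]
  simp

theorem div_bumpCurl (y : Plane) :
    fderiv ℝ bumpCurl y (planeBasis 0) 0 + fderiv ℝ bumpCurl y (planeBasis 1) 1 = 0 := by
  have h : IsSymmSndFDerivAt ℝ planeBump y :=
    contDiff_planeBump.contDiffAt.isSymmSndFDerivAt (by simp; norm_cast)
  rw [fderiv_bumpCurl_apply, fderiv_bumpCurl_apply]
  simp [h.eq (planeBasis 0) (planeBasis 1)]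

/-- Uniform bounds for the cutoff functions. -/
theorem exists_bump_bound : ∃ B : ℝ, 0 ≤ B ∧ ∀ y, ‖bumpCurl y‖ ≤ B ∧ ‖fderiv ℝ bumpCurl y‖ ≤ B ∧
    ‖fderiv ℝ planeBump y‖ ≤ B := by
  obtain ⟨B₁, h₁⟩ := hasCompactSupport_bumpCurl.exists_bound_of_continuous
    contDiff_bumpCurl.continuous
  obtain ⟨B₂, h₂⟩ := (hasCompactSupport_bumpCurl.fderiv ℝ).exists_bound_of_continuous
    (contDiff_bumpCurl.continuous_fderiv (by simp))
  obtain ⟨B₃, h₃⟩ := (planeBump.hasCompactSupport.fderiv ℝ).exists_bound_of_continuous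
    contDiff_fderiv_planeBump.continuous
  refine ⟨max B₁ (max B₂ B₃), ((norm_nonneg _).trans (h₁ 0)).trans (le_max_left _ _), fun y =>
    ⟨(h₁ y).trans (le_max_left _ _), (h₂ y).trans ((le_max_left _ _).trans (le_max_right _ _)),
      (h₃ y).trans ((le_max_right _ _).trans (le_max_right _ _))⟩⟩

/-- The parameters `((t, a), x)`: time, position of the moving point, position in the plane. -/
abbrev MovingFrame : Type := (ℝ × Plane) × Plane

/-- The map `((t, a), x) ↦ (t, x)`. -/
def spaceTime : MovingFrame →L[ℝ] ℝ × Plane :=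
  ((ContinuousLinearMap.fst ℝ ℝ Plane).comp (.fst ℝ (ℝ × Plane) Plane)).prod
    (.snd ℝ (ℝ × Plane) Plane)

/-- The map `((t, a), x) ↦ x - a`. -/
def offset : MovingFrame →L[ℝ] Plane :=
  ContinuousLinearMap.snd ℝ (ℝ × Plane) Plane -
    (ContinuousLinearMap.snd ℝ ℝ Plane).comp (.fst ℝ (ℝ × Plane) Plane)

theorem spaceTime_apply (z : MovingFrame) : spaceTime z = (z.1.1, z.2) := rfl

theorem offset_apply (z : MovingFrame) : offset z = z.2 - z.1.2 := rfl

theorem norm_spaceTime_le : ‖spaceTime‖ ≤ 1 := by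
  refine ContinuousLinearMap.opNorm_le_bound _ zero_le_one fun z => ?_
  rw [one_mul, spaceTime_apply, Prod.norm_mk]
  exact max_le ((norm_fst_le z.1).trans (norm_fst_le z)) (norm_snd_le z)

theorem norm_offset_le : ‖offset‖ ≤ 2 := by
  refine ContinuousLinearMap.opNorm_le_bound _ zero_le_two fun z => ?_
  rw [offset_apply, two_mul]
  exact (norm_sub_le _ _).trans
    (add_le_add (norm_snd_le z) ((norm_snd_le z.1).trans (norm_fst_le z)))

/-- The part of the field `f` removed near the moving point `a`, at scale `η`: the rotated gradient
of `ζ((x - a) / η) (ψ(t, x) - ψ(t, a))`, where `ψ` is the stream function of `f`. -/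
def correction (f : ℝ × Plane → Plane) (η : ℝ) (z : MovingFrame) : Plane :=
  (η⁻¹ * (streamFunction f (spaceTime z) - streamFunction f z.1)) • bumpCurl (η⁻¹ • offset z)
    + planeBump (η⁻¹ • offset z) • f (spaceTime z)

section Correction

variable {f : ℝ × Plane → Plane} {η : ℝ}

theorem contDiff_correction (hf : ContDiff ℝ ∞ f) (hc : HasCompactSupport f) :
    ContDiff ℝ ∞ (correction f η) := by
  have hψ := contDiff_streamFunction hf hc
  have hl : ContDiff ℝ ∞ fun z : MovingFrame => η⁻¹ • offset z := offset.contDiff.const_smul η⁻¹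
  exact ((contDiff_const.mul ((hψ.comp spaceTime.contDiff).sub (hψ.comp contDiff_fst))).smul
    (contDiff_bumpCurl.comp hl)).add
      ((contDiff_planeBump.comp hl).smul (hf.comp spaceTime.contDiff))

theorem one_lt_norm_smul_offset (hη : 0 < η) {z : MovingFrame} (hz : η < ‖offset z‖) :
    1 < ‖η⁻¹ • offset z‖ := by
  rw [norm_smul, norm_inv, Real.norm_of_nonneg hη.le, inv_mul_eq_div]
  exact (one_lt_div hη).2 hz

theorem correction_eq_zero (hη : 0 < η) {z : MovingFrame} (hz : η < ‖offset z‖) :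
    correction f η z = 0 := by
  have h := one_lt_norm_smul_offset hη hz
  simp [correction, bumpCurl_eq_zero h, planeBump_eq_zero h]

theorem correction_eq_self (hη : 0 < η) {z : MovingFrame} (hz : ‖offset z‖ < η / 2) :
    correction f η z = f (spaceTime z) := by
  have h : ‖η⁻¹ • offset z‖ < 1 / 2 := by
    rw [norm_smul, norm_inv, Real.norm_of_nonneg hη.le, inv_mul_eq_div, div_lt_iff₀ hη]
    linarith
  simp [correction, bumpCurl_eq_zero_of_lt h, planeBump_eq_one h]

theorem correction_eq_zero_of_time {t : ℝ} (h : ∀ x, f (t, x) = 0) (a x : Plane) :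
    correction f η ((t, a), x) = 0 := by
  simp [correction, spaceTime_apply, streamFunction_eq_zero h, h]

theorem fderiv_correction_eq_zero (hη : 0 < η) {z : MovingFrame} (hz : η < ‖offset z‖) :
    fderiv ℝ (correction f η) z = 0 := by
  have h : correction f η =ᶠ[𝓝 z] fun _ => (0 : Plane) := by
    filter_upwards [(isOpen_lt continuous_const offset.continuous.norm).mem_nhds hz] with w hw
    exact correction_eq_zero hη hw
  rw [h.fderiv_eq]
  simp

theorem hasLocallyCompactSupport_correction (hη : 0 < η) :
    HasLocallyCompactSupport (correction f η) := by
  intro p₀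
  refine ⟨Metric.closedBall 0 (‖p₀.2‖ + 1 + η), isCompact_closedBall _ _, ?_⟩
  filter_upwards [continuousAt_snd.norm.eventually_lt (continuousAt_const (y := ‖p₀.2‖ + 1))
    (by simp)] with p hp x hx
  rw [Metric.mem_closedBall, dist_zero_right, not_le] at hx
  refine correction_eq_zero hη ?_
  have h1 := norm_sub_norm_le x p.2
  rw [offset_apply]
  change ‖p.2‖ < ‖p₀.2‖ + 1 at hp
  change η < ‖x - p.2‖
  linarith

theorem hasLocallyCompactSupport_comp_spaceTime (hc : HasCompactSupport f) :
    HasLocallyCompactSupport fun z : MovingFrame => f (spaceTime z) := by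
  intro p₀
  refine ⟨Prod.snd '' tsupport f, hc.isCompact.image continuous_snd, .of_forall fun p x hx => ?_⟩
  exact image_eq_zero_of_notMem_tsupport fun h => hx ⟨_, h, rfl⟩

/-- The derivative of the correction. -/
theorem hasFDerivAt_correction (hf : ContDiff ℝ ∞ f) (hc : HasCompactSupport f)
    (z : MovingFrame) :
    HasFDerivAt (correction f η)
      (((η⁻¹ * (streamFunction f (spaceTime z) - streamFunction f z.1)) •
          (fderiv ℝ bumpCurl (η⁻¹ • offset z)).comp (η⁻¹ • offset)
        + (η⁻¹ • ((fderiv ℝ (streamFunction f) (spaceTime z)).comp spaceTime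
          - (fderiv ℝ (streamFunction f) z.1).comp (.fst ℝ (ℝ × Plane) Plane))).smulRight
            (bumpCurl (η⁻¹ • offset z)))
      + (planeBump (η⁻¹ • offset z) • (fderiv ℝ f (spaceTime z)).comp spaceTime
        + ((fderiv ℝ planeBump (η⁻¹ • offset z)).comp (η⁻¹ • offset)).smulRight
            (f (spaceTime z)))) z := by
  have hψ : Differentiable ℝ (streamFunction f) :=
    (contDiff_streamFunction hf hc).differentiable (by simp)
  have hl : HasFDerivAt (fun z : MovingFrame => η⁻¹ • offset z) (η⁻¹ • offset) z :=
    offset.hasFDerivAt.const_smul η⁻¹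
  have h1 : HasFDerivAt (fun z : MovingFrame => streamFunction f (spaceTime z))
      ((fderiv ℝ (streamFunction f) (spaceTime z)).comp spaceTime) z :=
    (hψ _).hasFDerivAt.comp z spaceTime.hasFDerivAt
  have h2 : HasFDerivAt (fun z : MovingFrame => streamFunction f z.1)
      ((fderiv ℝ (streamFunction f) z.1).comp (.fst ℝ (ℝ × Plane) Plane)) z :=
    (hψ _).hasFDerivAt.comp z hasFDerivAt_fst
  have h3 : HasFDerivAt (fun z : MovingFrame => bumpCurl (η⁻¹ • offset z))
      ((fderiv ℝ bumpCurl (η⁻¹ • offset z)).comp (η⁻¹ • offset)) z :=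
    ((contDiff_bumpCurl.differentiable (by simp)) _).hasFDerivAt.comp z hl
  have h4 : HasFDerivAt (fun z : MovingFrame => planeBump (η⁻¹ • offset z))
      ((fderiv ℝ planeBump (η⁻¹ • offset z)).comp (η⁻¹ • offset)) z :=
    ((contDiff_planeBump.differentiable (by simp)) _).hasFDerivAt.comp z hl
  have h5 : HasFDerivAt (fun z : MovingFrame => f (spaceTime z))
      ((fderiv ℝ f (spaceTime z)).comp spaceTime) z :=
    ((hf.differentiable (by simp)) _).hasFDerivAt.comp z spaceTime.hasFDerivAt
  exact (((h1.sub h2).const_mul η⁻¹).smul h3).add (h4.smul h5)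

theorem spaceTime_inr (y : Plane) : spaceTime ((0 : ℝ × Plane), y) = (0, y) := rfl

theorem offset_inr (y : Plane) : offset ((0 : ℝ × Plane), y) = y := by
  simp [offset_apply]

theorem div_correction (hf : ContDiff ℝ ∞ f) (hc : HasCompactSupport f)
    (hdiv : ∀ z, spaceDiv f z = 0) (z : MovingFrame) :
    ∑ i : Fin 2, fderiv ℝ (correction f η) z (0, planeBasis i) i = 0 := by
  have hd := hdiv (spaceTime z)
  have hb := div_bumpCurl (η⁻¹ • offset z)
  rw [spaceDiv, Fin.sum_univ_two] at hd
  rw [(hasFDerivAt_correction hf hc z).fderiv, Fin.sum_univ_two]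
  simp only [add_apply, smul_apply,
    ContinuousLinearMap.comp_apply, ContinuousLinearMap.smulRight_apply,
    sub_apply, spaceTime_inr, offset_inr, PiLp.add_apply, PiLp.smul_apply,
    ContinuousLinearMap.coe_fst', map_zero, sub_zero, map_smul, smul_eq_mul,
    fderiv_streamFunction_zero hf hc hdiv, fderiv_streamFunction_one hf hc, bumpCurl_zero,
    bumpCurl_one]
  -- Besides multiples of div ∇⊥ζ and div f there remain η⁻¹∇ψ·∇⊥ζ and η⁻¹∇ζ·f, which cancel because
  -- ∇ψ = (f₁, -f₀).
  linear_combination (η⁻¹ * (streamFunction f (spaceTime z) - streamFunction f z.1)) * η⁻¹ * hb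
    + planeBump (η⁻¹ • offset z) * hd

end Correction

/-! ### Uniform bounds for the correction -/

section Bounds

variable {f : ℝ × Plane → Plane}

theorem norm_fderiv_streamFunction_le (hf : ContDiff ℝ ∞ f) (hc : HasCompactSupport f)
    (hdiv : ∀ z, spaceDiv f z = 0) {t M ρ : ℝ} (hρ : 0 ≤ ρ) (hM : ∀ x, ‖f (t, x)‖ ≤ M)
    (hM' : ∀ x, ‖fderiv ℝ f (t, x)‖ ≤ M) (hsupp : ∀ x, ρ < ‖x‖ → fderiv ℝ f (t, x) = 0)
    (x : Plane) : ‖fderiv ℝ (streamFunction f) (t, x)‖ ≤ 2 * ρ * M + 2 * M := by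
  have hM0 : 0 ≤ M := (norm_nonneg _).trans (hM 0)
  refine ContinuousLinearMap.opNorm_le_bound _ (by positivity) fun v => ?_
  have hv : v = v.1 • ((1 : ℝ), (0 : Plane)) + ((0 : ℝ), v.2) := by
    ext <;> simp
  have h1 : fderiv ℝ (streamFunction f) (t, x) v
      = v.1 * fderiv ℝ (streamFunction f) (t, x) (1, 0)
        + (v.2 0 * f (t, x) 1 - v.2 1 * f (t, x) 0) := by
    conv_lhs => rw [hv]
    rw [map_add, map_smul, fderiv_streamFunction_space hf hc hdiv, smul_eq_mul]
  have hmul : ∀ i j, |v.2 i * f (t, x) j| ≤ ‖v‖ * M := fun i j => by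
    rw [abs_mul]
    exact mul_le_mul ((abs_coord_le_norm _ i).trans (norm_snd_le v))
      ((abs_coord_le_norm _ j).trans (hM x)) (abs_nonneg _) (norm_nonneg _)
  have h2 : |v.1 * fderiv ℝ (streamFunction f) (t, x) (1, 0)| ≤ ‖v‖ * (2 * ρ * M) := by
    rw [abs_mul]
    exact mul_le_mul (norm_fst_le v) (abs_fderiv_streamFunction_time_le hf hc hM' hρ hsupp x)
      (abs_nonneg _) (norm_nonneg _)
  rw [h1, Real.norm_eq_abs]
  refine (abs_add_le _ _).trans ((add_le_add h2 ((abs_sub _ _).trans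
    (add_le_add (hmul 0 1) (hmul 1 0)))).trans_eq ?_)
  ring

theorem abs_streamFunction_sub_le (hf : ContDiff ℝ ∞ f) (hc : HasCompactSupport f) {t K : ℝ}
    (hK : ∀ x, ‖fderiv ℝ (streamFunction f) (t, x)‖ ≤ K) (a x : Plane) :
    |streamFunction f (t, x) - streamFunction f (t, a)| ≤ K * ‖x - a‖ := by
  have hd : ∀ y, HasFDerivAt (fun y => streamFunction f (t, y))
      ((fderiv ℝ (streamFunction f) (t, y)).comp (.inr ℝ ℝ Plane)) y := fun y =>
    (((contDiff_streamFunction hf hc).differentiable (by simp)) (t, y)).hasFDerivAt.comp y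
      (hasFDerivAt_prodMk_right t y)
  refine convex_univ.norm_image_sub_le_of_norm_hasFDerivWithin_le
    (fun y _ => (hd y).hasFDerivWithinAt) (fun y _ => ?_) (mem_univ a) (mem_univ x)
  refine (ContinuousLinearMap.opNorm_comp_le _ _).trans ?_
  refine (mul_le_mul_of_nonneg_left (ContinuousLinearMap.norm_inr_le_one ℝ ℝ Plane)
    (norm_nonneg _)).trans ?_
  rw [mul_one]
  exact hK y

/-- As ψ is Lipschitz in space, η⁻¹(ψ(t,x) - ψ(t,a)) is bounded on the disc, so one derivative costs
a single factor η⁻¹. C depends on M and ρ alone, and f is controlled at the single time t, because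
the estimate will be applied to time shifts that vary with η and are controlled uniformly for t > 0
only. -/
theorem exists_correction_bound (M ρ : ℝ) (hM0 : 0 ≤ M) (hρ : 0 ≤ ρ) : ∃ C : ℝ, 0 ≤ C ∧
    ∀ f : ℝ × Plane → Plane, ContDiff ℝ ∞ f → HasCompactSupport f → (∀ z, spaceDiv f z = 0) →
      ∀ t, (∀ x, ‖f (t, x)‖ ≤ M) → (∀ x, ‖fderiv ℝ f (t, x)‖ ≤ M) →
        (∀ x, ρ < ‖x‖ → fderiv ℝ f (t, x) = 0) → ∀ η, 0 < η → η ≤ 1 → ∀ a x,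
          ‖correction f η ((t, a), x)‖ ≤ C / η ∧
            ‖fderiv ℝ (correction f η) ((t, a), x)‖ ≤ C / η := by
  obtain ⟨B, hB, hbump⟩ := exists_bump_bound
  set K := 2 * ρ * M + 2 * M with hK
  have hK0 : 0 ≤ K := by positivity
  -- 4KB bounds the derivative of the ∇⊥ζ term and 2BM + M that of ζf; the extra KB is for the value
  -- of the correction.
  refine ⟨4 * K * B + K * B + 2 * B * M + M, by positivity, ?_⟩
  intro f hf hc hdiv t hM hM' hsupp η hη hη1 a x
  have hKb := norm_fderiv_streamFunction_le hf hc hdiv hρ hM hM' hsupp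
  rw [← hK] at hKb
  set z : MovingFrame := ((t, a), x) with hz
  rcases lt_or_ge η ‖offset z‖ with hlt | hle
  · rw [correction_eq_zero hη hlt, fderiv_correction_eq_zero hη hlt, norm_zero, norm_zero]
    constructor <;> positivity
  obtain ⟨hb1, hb2, hb3⟩ := hbump (η⁻¹ • offset z)
  have hg : |η⁻¹ * (streamFunction f (spaceTime z) - streamFunction f z.1)| ≤ K := by
    rw [abs_mul, abs_of_pos (inv_pos.2 hη), inv_mul_le_iff₀ hη]
    refine (abs_streamFunction_sub_le hf hc hKb a x).trans ?_
    rw [mul_comm η]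
    exact mul_le_mul_of_nonneg_left hle hK0
  have hζ : |planeBump (η⁻¹ • offset z)| ≤ 1 := by
    rw [abs_of_nonneg planeBump.nonneg]
    exact planeBump.le_one
  have hη2 : 1 ≤ η⁻¹ := (one_le_inv₀ hη).2 hη1
  have hoff : ‖η⁻¹ • offset‖ ≤ 2 * η⁻¹ := by
    rw [norm_smul, norm_inv, Real.norm_of_nonneg hη.le, mul_comm]
    exact mul_le_mul_of_nonneg_right norm_offset_le (by positivity)
  rw [div_eq_mul_inv]
  constructor
  · refine (norm_add_le _ _).trans ?_
    rw [norm_smul, norm_smul]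
    have h1 : ‖η⁻¹ * (streamFunction f (spaceTime z) - streamFunction f z.1)‖
        * ‖bumpCurl (η⁻¹ • offset z)‖ ≤ K * B := mul_le_mul hg hb1 (norm_nonneg _) hK0
    have h2 : ‖planeBump (η⁻¹ • offset z)‖ * ‖f (spaceTime z)‖ ≤ 1 * M :=
      mul_le_mul hζ (hM x) (norm_nonneg _) zero_le_one
    have h3 : 4 * K * B + K * B + 2 * B * M + M
        ≤ (4 * K * B + K * B + 2 * B * M + M) * η⁻¹ :=
      le_mul_of_one_le_right (by positivity) hη2
    have h4 : 0 ≤ 4 * K * B + 2 * B * M := by positivity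
    linarith
  · rw [(hasFDerivAt_correction hf hc z).fderiv]
    have h1 : ‖(η⁻¹ * (streamFunction f (spaceTime z) - streamFunction f z.1)) •
        (fderiv ℝ bumpCurl (η⁻¹ • offset z)).comp (η⁻¹ • offset)‖ ≤ K * (B * (2 * η⁻¹)) := by
      rw [norm_smul]
      exact mul_le_mul hg ((ContinuousLinearMap.opNorm_comp_le _ _).trans
        (mul_le_mul hb2 hoff (norm_nonneg _) hB)) (norm_nonneg _) hK0
    have h2 : ‖(η⁻¹ • ((fderiv ℝ (streamFunction f) (spaceTime z)).comp spaceTime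
          - (fderiv ℝ (streamFunction f) z.1).comp (.fst ℝ (ℝ × Plane) Plane))).smulRight
            (bumpCurl (η⁻¹ • offset z))‖ ≤ η⁻¹ * (K + K) * B := by
      rw [ContinuousLinearMap.norm_smulRight_apply]
      refine mul_le_mul ?_ hb1 (norm_nonneg _) (by positivity)
      rw [norm_smul, norm_inv, Real.norm_of_nonneg hη.le]
      refine mul_le_mul_of_nonneg_left ((norm_sub_le _ _).trans (add_le_add ?_ ?_))
        (by positivity)
      · refine (ContinuousLinearMap.opNorm_comp_le _ _).trans
          ((mul_le_mul (hKb x) norm_spaceTime_le (norm_nonneg _) hK0).trans_eq (mul_one K))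
      · refine (ContinuousLinearMap.opNorm_comp_le _ _).trans
          ((mul_le_mul (hKb a) (ContinuousLinearMap.norm_fst_le ℝ (ℝ × Plane) Plane)
            (norm_nonneg _) hK0).trans_eq (mul_one K))
    have h3 : ‖planeBump (η⁻¹ • offset z) • (fderiv ℝ f (spaceTime z)).comp spaceTime‖
        ≤ 1 * (M * 1) := by
      rw [norm_smul]
      exact mul_le_mul hζ ((ContinuousLinearMap.opNorm_comp_le _ _).trans
        (mul_le_mul (hM' x) norm_spaceTime_le (norm_nonneg _) hM0)) (norm_nonneg _) zero_le_one
    have h4 : ‖((fderiv ℝ planeBump (η⁻¹ • offset z)).comp (η⁻¹ • offset)).smulRight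
            (f (spaceTime z))‖ ≤ B * (2 * η⁻¹) * M := by
      rw [ContinuousLinearMap.norm_smulRight_apply]
      exact mul_le_mul ((ContinuousLinearMap.opNorm_comp_le _ _).trans
        (mul_le_mul hb3 hoff (norm_nonneg _) hB)) (hM x) (norm_nonneg _) (by positivity)
    refine (norm_add_le _ _).trans ((add_le_add ((norm_add_le _ _).trans (add_le_add h1 h2))
      ((norm_add_le _ _).trans (add_le_add h3 h4))).trans ?_)
    have h5 : M ≤ M * η⁻¹ := le_mul_of_one_le_right hM0 hη2
    have h6 : 0 ≤ K * B * η⁻¹ := by positivity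
    nlinarith

end Bounds

/-! ### Strongly convergent fields perturbed by concentrating fields -/

section Perturbation

/-- The square root of the area of the unit disc. -/
def discConst : ℝ := √(volume.real (Metric.ball (0 : Plane) 1))

theorem discConst_nonneg : 0 ≤ discConst := Real.sqrt_nonneg _

/-- The square root of the area of the disc is η times `discConst`, which exactly absorbs the factor
1/η. -/
theorem norm_ofField_le_of_concentrated {r : Plane → Plane} {a : Plane} {C η : ℝ} (hη : 0 < η)
    (hr : MemLp r 2 (volume : Measure Plane)) (hC : 0 ≤ C) (hb : ∀ x, ‖r x‖ ≤ C / η)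
    (h0 : ∀ x ∉ Metric.closedBall a η, r x = 0) : ‖L2Field.ofField r‖ ≤ C * discConst := by
  refine (L2Field.norm_ofField_le hr Metric.isClosed_closedBall.measurableSet
    measure_closedBall_lt_top.ne (by positivity) (fun x _ => hb x) h0).trans_eq ?_
  have h1 : volume.real (Metric.closedBall a η)
      = η ^ 2 * volume.real (Metric.ball (0 : Plane) 1) := by
    rw [Measure.real, Measure.addHaar_closedBall volume a hη.le, ENNReal.toReal_mul,
      ENNReal.toReal_ofReal (by positivity), finrank_euclideanSpace_fin]
    rfl
  rw [h1, Real.sqrt_mul (by positivity), Real.sqrt_sq hη.le, discConst]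
  field_simp

variable {g : ℝ × Plane → Plane} {ρ : ℝ}

theorem continuousAt_l2Slice_of_continuousOn (hg : ContinuousOn g (Ioi 0 ×ˢ univ))
    (h0 : ∀ t, 0 < t → ∀ x, ρ < ‖x‖ → g (t, x) = 0) {t : ℝ} (ht : 0 < t) :
    ContinuousAt (l2Slice g) t := by
  refine L2Field.continuousAt_ofField (f := fun p x => g (p, x)) (isCompact_closedBall 0 ρ)
    ?_ ?_ fun x _ => hg.continuousAt ((isOpen_Ioi.prod isOpen_univ).mem_nhds ⟨ht, mem_univ x⟩)
  · filter_upwards [isOpen_Ioi.mem_nhds ht] with s hs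
    exact hg.comp_continuous (by fun_prop) fun x => ⟨hs, mem_univ x⟩
  · filter_upwards [isOpen_Ioi.mem_nhds ht] with s hs x hx
    refine h0 s hs x ?_
    simpa using hx

theorem memLp_slice_of_continuousOn (hg : ContinuousOn g (Ioi 0 ×ˢ univ))
    (h0 : ∀ t, 0 < t → ∀ x, ρ < ‖x‖ → g (t, x) = 0) {t : ℝ} (ht : 0 < t) :
    MemLp (fun x => g (t, x)) 2 (volume : Measure Plane) :=
  L2Field.memLp_of_continuous (hg.comp_continuous (by fun_prop) fun x => ⟨ht, mem_univ x⟩)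
    (isCompact_closedBall 0 ρ) fun x hx => h0 t ht x (by simpa using hx)

theorem norm_l2Slice_le (hg : ContinuousOn g (Ioi 0 ×ˢ univ))
    (h0 : ∀ t, 0 < t → ∀ x, ρ < ‖x‖ → g (t, x) = 0) {M : ℝ} (hM0 : 0 ≤ M)
    (hM : ∀ t, 0 < t → ∀ x, ‖g (t, x)‖ ≤ M) {t : ℝ} (ht : 0 < t) :
    ‖l2Slice g t‖ ≤ M * √(volume.real (Metric.closedBall (0 : Plane) ρ)) :=
  L2Field.norm_ofField_le (memLp_slice_of_continuousOn hg h0 ht)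
    Metric.isClosed_closedBall.measurableSet measure_closedBall_lt_top.ne hM0
    (fun x _ => hM t ht x) fun x hx => h0 t ht x (by simpa using hx)

/-- The shifted slice converges strongly, while r η is bounded in L² and concentrates at a, hence
tends weakly to 0. This serves the field, its space derivatives and its time derivative alike. -/
theorem tendsto_inner_l2Slice_sub (hg : ContinuousOn g (Ioi 0 ×ˢ univ))
    (h0 : ∀ t, 0 < t → ∀ x, ρ < ‖x‖ → g (t, x) = 0) {t : ℝ} (ht : 0 < t)
    {r : ℝ → Plane → Plane} {a : Plane} {C : ℝ} (hC : 0 ≤ C)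
    (hr : ∀ η, 0 < η → η ≤ 1 → MemLp (r η) 2 (volume : Measure Plane))
    (hb : ∀ η, 0 < η → η ≤ 1 → ∀ x, ‖r η x‖ ≤ C / η)
    (hr0 : ∀ η, 0 < η → η ≤ 1 → ∀ x ∉ Metric.closedBall a η, r η x = 0) (w : L2Field) :
    Tendsto (fun η => inner ℝ w (l2Slice g (t + η) - L2Field.ofField (r η))) (𝓝[>] 0)
      (𝓝 (inner ℝ w (l2Slice g t))) := by
  have h1 : ∀ᶠ η : ℝ in 𝓝[>] 0, 0 < η ∧ η ≤ 1 := by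
    filter_upwards [Ioc_mem_nhdsGT (zero_lt_one' ℝ)] with η hη
    exact hη
  have hid : Tendsto (fun η : ℝ => η) (𝓝[>] 0) (𝓝 0) := tendsto_id.mono_left nhdsWithin_le_nhds
  have h2 : Tendsto (fun η => inner ℝ w (L2Field.ofField (r η))) (𝓝[>] 0) (𝓝 0) :=
    tendsto_inner_ofField_of_concentrating (r := fun η => η) hid
      (h1.mono fun η hη => hη.1.le) (h1.mono fun η hη => hr η hη.1 hη.2)
      (h1.mono fun η hη => hr0 η hη.1 hη.2)
      (h1.mono fun η hη => norm_ofField_le_of_concentrated hη.1 (hr η hη.1 hη.2) hC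
        (hb η hη.1 hη.2) (hr0 η hη.1 hη.2)) w
  have h3 : Tendsto (fun η => l2Slice g (t + η)) (𝓝[>] 0) (𝓝 (l2Slice g t)) := by
    refine (continuousAt_l2Slice_of_continuousOn hg h0 ht).tendsto.comp ?_
    simpa using hid.const_add t
  have h4 := (tendsto_const_nhds (x := w)).inner (𝕜 := ℝ) h3
  simpa only [inner_sub_right, sub_zero] using h4.sub h2

end Perturbation

/-! ### Test fields and their time shifts -/

theorem spaceDiv_eq_classicalDiv {f : ℝ × Plane → Plane} (hf : Differentiable ℝ f) (t : ℝ)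
    (x : Plane) : spaceDiv f (t, x) = classicalDiv (fun x => f (t, x)) x := by
  rw [spaceDiv, classicalDiv, (hasFDerivAt_slice hf t x).fderiv]
  rfl

theorem classicalDiv_const_smul (c : ℝ) (f : Plane → Plane) (x : Plane) :
    classicalDiv (fun x => c • f x) x = c * classicalDiv f x := by
  have h : fderiv ℝ (fun x => c • f x) x = c • fderiv ℝ f x :=
    congrFun (fderiv_const_smul_field c) x
  rw [classicalDiv, classicalDiv, h, Finset.mul_sum]
  rfl

/-- A field on `ℝ × ℝ²` that is smooth for positive times, has bounded support and bounded first
derivatives there, and is divergence free. -/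
structure IsPositiveTimeField (T' ρ M : ℝ) (f : ℝ × Plane → Plane) : Prop where
  contDiffOn : ContDiffOn ℝ ∞ f (Ioi 0 ×ˢ univ)
  eq_zero_of_le : ∀ t, T' ≤ t → ∀ x, f (t, x) = 0
  eq_zero_of_lt_norm : ∀ t x, ρ < ‖x‖ → f (t, x) = 0
  norm_le : ∀ t, 0 < t → ∀ x, ‖f (t, x)‖ ≤ M
  norm_fderiv_le : ∀ t, 0 < t → ∀ x, ‖fderiv ℝ f (t, x)‖ ≤ M
  classicalDiv_eq_zero : ∀ t, 0 < t → ∀ x, classicalDiv (fun x => f (t, x)) x = 0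

theorem isOpen_positiveTime : IsOpen (Ioi (0 : ℝ) ×ˢ (univ : Set Plane)) :=
  isOpen_Ioi.prod isOpen_univ

theorem IsTestField.exists_isPositiveTimeField {T : ℝ} (hT : 0 < T) {φ : ℝ → Plane → Plane}
    (hφ : IsTestField T φ) (hdiv : ∀ t ∈ Ico 0 T, ∀ x, classicalDiv (φ t) x = 0) :
    ∃ (f : ℝ × Plane → Plane) (T' ρ M : ℝ), T' ∈ Ico 0 T ∧ 0 ≤ ρ ∧ 0 ≤ M ∧
      IsPositiveTimeField T' ρ M f ∧ ∀ t ∈ Ioo 0 T, ∀ x, f (t, x) = φ t x := by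
  classical
  obtain ⟨K, hK, hKsub, hK0⟩ := hφ.compactSupport
  obtain ⟨T', hT', hT'K⟩ : ∃ T' ∈ Ico 0 T, ∀ z ∈ K, z.1 ≤ T' := by
    -- Inserting 0 provides a supremum in [0, T) even when K is empty.
    have hc : IsCompact (insert 0 (Prod.fst '' K)) := (hK.image continuous_fst).insert 0
    have hsub : insert 0 (Prod.fst '' K) ⊆ Ico 0 T := by
      refine insert_subset (left_mem_Ico.2 hT) ?_
      rintro _ ⟨z, hz, rfl⟩
      exact (hKsub hz).1
    exact ⟨_, hsub (hc.sSup_mem (insert_nonempty _ _)), fun z hz =>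
      le_csSup hc.bddAbove (mem_insert_of_mem _ (mem_image_of_mem _ hz))⟩
  obtain ⟨ρ, hρK⟩ : ∃ ρ, ∀ z ∈ K, ‖z.2‖ ≤ ρ := by
    obtain ⟨ρ, hρ⟩ := (hK.image continuous_snd).isBounded.subset_closedBall 0
    exact ⟨ρ, fun z hz => by simpa using hρ (mem_image_of_mem _ hz)⟩
  set S : Set (ℝ × Plane) := Ico 0 T ×ˢ univ with hS
  -- Unique differentiability makes the derivative within S continuous up to t = 0, so compactness
  -- of K bounds it uniformly for small positive times.
  have hSu : UniqueDiffOn ℝ S := (uniqueDiffOn_Ico 0 T).prod uniqueDiffOn_univ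
  have hDc : ContinuousOn (fderivWithin ℝ (Function.uncurry φ) S) S :=
    hφ.contDiffOn.continuousOn_fderivWithin hSu (by simp)
  obtain ⟨M₀, hM₀⟩ := hK.exists_bound_of_continuousOn (hφ.contDiffOn.continuousOn.mono hKsub)
  obtain ⟨M₁, hM₁⟩ := hK.exists_bound_of_continuousOn (hDc.mono hKsub)
  set M := max 0 (max M₀ M₁) with hM
  have hDbound : ∀ z ∈ S, ‖fderivWithin ℝ (Function.uncurry φ) S z‖ ≤ M := by
    intro z hz
    by_cases hzK : z ∈ K
    · exact (hM₁ z hzK).trans ((le_max_right _ _).trans (le_max_right _ _))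
    · have h : Function.uncurry φ =ᶠ[𝓝[S] z] fun _ => 0 := by
        filter_upwards [self_mem_nhdsWithin,
          mem_nhdsWithin_of_mem_nhds (hK.isClosed.isOpen_compl.mem_nhds hzK)] with w hw hwK
        exact hK0 w.1 hw.1 w.2 hwK
      rw [h.fderivWithin_eq (hK0 z.1 hz.1 z.2 hzK)]
      simp [hM]
  -- Extension by zero is smooth across T, as φ vanishes after T' < T; a jump at t = 0 is harmless,
  -- since regularity is asked for positive times only.
  set f : ℝ × Plane → Plane := fun z => if z.1 ∈ Ioo 0 T then φ z.1 z.2 else 0 with hf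
  have hfφ : ∀ t ∈ Ioo 0 T, ∀ x, f (t, x) = φ t x := fun t ht x => if_pos ht
  have hopen : IsOpen (Ioo 0 T ×ˢ (univ : Set Plane)) := isOpen_Ioo.prod isOpen_univ
  have hev : ∀ z : ℝ × Plane, z.1 ∈ Ioo 0 T → f =ᶠ[𝓝 z] Function.uncurry φ := by
    intro z hz
    filter_upwards [hopen.mem_nhds ⟨hz, mem_univ z.2⟩] with w hw
    exact hfφ w.1 hw.1 w.2
  have hSn : ∀ z : ℝ × Plane, z.1 ∈ Ioo 0 T → S ∈ 𝓝 z := fun z hz =>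
    mem_of_superset (hopen.mem_nhds ⟨hz, mem_univ z.2⟩)
      (prod_mono Ioo_subset_Ico_self subset_rfl)
  have hzero : ∀ t, T' < t → ∀ x, f (t, x) = 0 := by
    intro t ht x
    by_cases h : t ∈ Ioo 0 T
    · rw [hfφ t h]
      exact hK0 t (Ioo_subset_Ico_self h) x fun hz => (hT'K _ hz).not_gt ht
    · exact if_neg h
  have hev0 : ∀ z : ℝ × Plane, T' < z.1 → f =ᶠ[𝓝 z] fun _ => 0 := by
    intro z hz
    filter_upwards [(isOpen_lt continuous_const continuous_fst).mem_nhds hz] with w hw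
    exact hzero w.1 hw w.2
  have hcase : ∀ t, 0 < t → t ∈ Ioo 0 T ∨ T' < t := fun t ht => by
    rcases lt_or_ge t T with h | h
    · exact Or.inl ⟨ht, h⟩
    · exact Or.inr (hT'.2.trans_le h)
  -- f is known to vanish for t > T'; passing to T'' > T' includes the endpoint.
  obtain ⟨T'', hT''1, hT''2⟩ := exists_between hT'.2
  refine ⟨f, T'', max 0 ρ, M, ⟨hT'.1.trans hT''1.le, hT''2⟩, le_max_left _ _, le_max_left _ _,
    ⟨?_, fun t ht x => hzero t (hT''1.trans_le ht) x, ?_, ?_, ?_, ?_⟩, hfφ⟩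
  · intro z hz
    refine ContDiffAt.contDiffWithinAt ?_
    rcases hcase z.1 hz.1 with h | h
    · exact (hφ.contDiffOn.contDiffAt (hSn z h)).congr_of_eventuallyEq (hev z h)
    · exact contDiffAt_const.congr_of_eventuallyEq (hev0 z h)
  · intro t x hx
    by_cases h : t ∈ Ioo 0 T
    · rw [hfφ t h]
      exact hK0 t (Ioo_subset_Ico_self h) x fun hz =>
        (hρK _ hz).not_gt ((le_max_right _ _).trans_lt hx)
    · exact if_neg h
  · intro t ht x
    rcases hcase t ht with h | h
    · rw [hfφ t h]
      by_cases hzK : (t, x) ∈ K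
      · exact (hM₀ _ hzK).trans ((le_max_left _ _).trans (le_max_right _ _))
      · rw [hK0 t (Ioo_subset_Ico_self h) x hzK, norm_zero]
        exact le_max_left _ _
    · rw [hzero t h, norm_zero]
      exact le_max_left _ _
  · intro t ht x
    rcases hcase t ht with h | h
    · rw [(hev (t, x) h).fderiv_eq, ← fderivWithin_of_mem_nhds (hSn (t, x) h)]
      exact hDbound _ ⟨Ioo_subset_Ico_self h, mem_univ x⟩
    · rw [(hev0 (t, x) h).fderiv_eq]
      simp [hM]
  · intro t ht x
    rcases hcase t ht with h | h
    · simp_rw [hfφ t h]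
      exact hdiv t (Ioo_subset_Ico_self h) x
    · simp_rw [hzero t h]
      simp [classicalDiv]

/-- The shift by `η` of a field in time, cut off for negative times. -/
def timeShift (f : ℝ × Plane → Plane) (η : ℝ) (z : ℝ × Plane) : Plane :=
  Real.smoothTransition (1 + 2 * z.1 / η) • f (z.1 + η, z.2)

namespace IsPositiveTimeField

variable {T' ρ M η : ℝ} {f : ℝ × Plane → Plane}

/-- The cutoff is 1 from t = 0 on, so its derivatives of size 1/η never enter the estimates on (0,
T). -/
theorem timeShift_eq (hη : 0 < η) {t : ℝ} (ht : 0 ≤ t) (x : Plane) :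
    timeShift f η (t, x) = f (t + η, x) := by
  rw [timeShift, Real.smoothTransition.one_of_one_le, one_smul]
  have : 0 ≤ 2 * t / η := by positivity
  linarith

theorem timeShift_eq_zero (hη : 0 < η) {t : ℝ} (ht : t ≤ -η / 2) (x : Plane) :
    timeShift f η (t, x) = 0 := by
  rw [timeShift, Real.smoothTransition.zero_of_nonpos, zero_smul]
  have : 2 * t / η ≤ -1 := by
    rw [div_le_iff₀ hη]
    linarith
  linarith

theorem fderiv_timeShift (hη : 0 < η) {t : ℝ} (ht : 0 < t) (x : Plane) :
    fderiv ℝ (timeShift f η) (t, x) = fderiv ℝ f (t + η, x) := by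
  have h : timeShift f η =ᶠ[𝓝 (t, x)] fun z => f (z + (η, 0)) := by
    filter_upwards [isOpen_positiveTime.mem_nhds ⟨ht, mem_univ x⟩] with w hw
    rw [← Prod.mk.eta (p := w), timeShift_eq hη (le_of_lt hw.1), Prod.mk_add_mk, add_zero]
  rw [h.fderiv_eq, fderiv_comp_add_right, Prod.mk_add_mk, add_zero]

/-- The shifted field is smooth for t > -η, and the cutoff vanishes for t < -η/2; these two open
regions cover all times. -/
theorem contDiff_timeShift (hf : IsPositiveTimeField T' ρ M f) (hη : 0 < η) : ContDiff ℝ ∞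
    (timeShift f η) := by
  refine contDiff_iff_contDiffAt.2 fun z => ?_
  rcases lt_or_ge (-η) z.1 with h | h
  · have h1 : ContDiffAt ℝ ∞ (fun z : ℝ × Plane => f (z.1 + η, z.2)) z := by
      have h2 : ContDiffAt ℝ ∞ f (z.1 + η, z.2) := hf.contDiffOn.contDiffAt
        (isOpen_positiveTime.mem_nhds ⟨show 0 < z.1 + η by linarith, mem_univ _⟩)
      exact h2.comp z ((contDiff_fst.add contDiff_const).prodMk contDiff_snd).contDiffAt
    have h3 : ContDiff ℝ ∞ fun z : ℝ × Plane => Real.smoothTransition (1 + 2 * z.1 / η) :=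
      Real.smoothTransition.contDiff.comp
        (contDiff_const.add ((contDiff_const.mul contDiff_fst).div_const η))
    exact h3.contDiffAt.smul h1
  · have h1 : timeShift f η =ᶠ[𝓝 z] fun _ => 0 := by
      have h2 : z.1 < -η / 2 := by linarith
      filter_upwards [(isOpen_lt continuous_fst continuous_const).mem_nhds h2] with w hw
      exact timeShift_eq_zero hη (le_of_lt hw) w.2
    exact contDiffAt_const.congr_of_eventuallyEq h1

theorem timeShift_eq_zero_of_le (hf : IsPositiveTimeField T' ρ M f) (hη : 0 < η) {t : ℝ}
    (ht : T' ≤ t) (x : Plane) :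
    timeShift f η (t, x) = 0 := by
  rw [timeShift, hf.eq_zero_of_le (t + η) (by linarith), smul_zero]

theorem hasCompactSupport_timeShift (hf : IsPositiveTimeField T' ρ M f) (hη : 0 < η)
    : HasCompactSupport (timeShift f η) := by
  refine HasCompactSupport.intro
    ((isCompact_Icc (a := -η / 2) (b := T')).prod (isCompact_closedBall (0 : Plane) ρ))
    fun z hz => ?_
  by_contra hne
  refine hz ⟨⟨?_, ?_⟩, ?_⟩
  · by_contra h
    exact hne (timeShift_eq_zero hη (not_le.1 h).le z.2)
  · by_contra h
    exact hne (hf.timeShift_eq_zero_of_le hη (not_le.1 h).le z.2)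
  · rw [Metric.mem_closedBall, dist_zero_right]
    by_contra h
    exact hne (by rw [timeShift, hf.eq_zero_of_lt_norm _ _ (not_le.1 h), smul_zero])

theorem spaceDiv_timeShift (hf : IsPositiveTimeField T' ρ M f) (hη : 0 < η) (z : ℝ × Plane)
    : spaceDiv (timeShift f η) z = 0 := by
  have hd := (hf.contDiff_timeShift hη).differentiable (by simp)
  rw [← Prod.mk.eta (p := z), spaceDiv_eq_classicalDiv hd]
  rcases lt_or_ge (-η) z.1 with h | h
  · simp only [timeShift]
    rw [classicalDiv_const_smul, hf.classicalDiv_eq_zero _ (by linarith), mul_zero]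
  · simp_rw [timeShift_eq_zero hη (show z.1 ≤ -η / 2 by linarith)]
    simp [classicalDiv]

theorem fderiv_eq_zero_of_lt_norm (hf : IsPositiveTimeField T' ρ M f) (t : ℝ) (x : Plane)
    (hx : ρ < ‖x‖) :
    fderiv ℝ f (t, x) = 0 := by
  have h : f =ᶠ[𝓝 (t, x)] fun _ => 0 := by
    filter_upwards [(isOpen_lt continuous_const continuous_snd.norm).mem_nhds hx] with w hw
    exact hf.eq_zero_of_lt_norm w.1 w.2 hw
  rw [h.fderiv_eq]
  simp

theorem continuousOn_fderiv_apply (hf : IsPositiveTimeField T' ρ M f) (v : ℝ × Plane) :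
    ContinuousOn (fun z => fderiv ℝ f z v) (Ioi 0 ×ˢ univ) :=
  (hf.contDiffOn.continuousOn_fderiv_of_isOpen isOpen_positiveTime (by simp)).clm_apply
    continuousOn_const

theorem contDiff_slice (hf : IsPositiveTimeField T' ρ M f) {t : ℝ} (ht : 0 < t)
    : ContDiff ℝ 1 fun x => f (t, x) := by
  refine contDiff_iff_contDiffAt.2 fun x => ?_
  have h : ContDiffAt ℝ ∞ f (t, x) :=
    hf.contDiffOn.contDiffAt (isOpen_positiveTime.mem_nhds ⟨ht, mem_univ x⟩)
  exact (h.of_le (by norm_cast)).comp x (contDiff_prodMk_right t).contDiffAt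

theorem hasCompactSupport_slice (hf : IsPositiveTimeField T' ρ M f) (t : ℝ)
    : HasCompactSupport fun x => f (t, x) :=
  HasCompactSupport.intro (isCompact_closedBall 0 ρ) fun x hx =>
    hf.eq_zero_of_lt_norm t x (by simpa using hx)

theorem differentiableAt (hf : IsPositiveTimeField T' ρ M f) {t : ℝ} (ht : 0 < t) (x : Plane)
    : DifferentiableAt ℝ f (t, x) :=
  (hf.contDiffOn.contDiffAt (isOpen_positiveTime.mem_nhds
    (show (t, x) ∈ Ioi (0 : ℝ) ×ˢ univ from ⟨ht, mem_univ x⟩))).differentiableAt (by simp)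

theorem component_h1Slice_eq (hf : IsPositiveTimeField T' ρ M f) {t : ℝ} (ht : 0 < t)
    (o : Option (Fin 2)) :
    H1Field.component o (h1Slice f t) = l2Slice (spatial o f) t := by
  cases o with
  | none =>
    exact H1Field.component_ofField_none (hf.contDiff_slice ht) (hf.hasCompactSupport_slice t)
  | some j =>
    refine (H1Field.component_ofField_some (hf.contDiff_slice ht)
      (hf.hasCompactSupport_slice t) j).trans ?_
    refine congrArg L2Field.ofField (funext fun x => ?_)
    have h : HasFDerivAt (fun x => f (t, x)) ((fderiv ℝ f (t, x)).comp (.inr ℝ ℝ Plane)) x :=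
      (hf.differentiableAt ht x).hasFDerivAt.comp x (hasFDerivAt_prodMk_right t x)
    rw [h.fderiv]
    rfl

theorem continuousOn_spatial (hf : IsPositiveTimeField T' ρ M f) (o : Option (Fin 2)) :
    ContinuousOn (spatial o f) (Ioi 0 ×ˢ univ) := by
  cases o with
  | none => exact hf.contDiffOn.continuousOn
  | some j => exact hf.continuousOn_fderiv_apply _

theorem spatial_eq_zero (hf : IsPositiveTimeField T' ρ M f) (o : Option (Fin 2)) (t : ℝ)
    (x : Plane) (hx : ρ < ‖x‖) :
    spatial o f (t, x) = 0 := by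
  cases o with
  | none => exact hf.eq_zero_of_lt_norm t x hx
  | some j => simp [spatial, hf.fderiv_eq_zero_of_lt_norm t x hx]

theorem norm_fderiv_apply_le (hf : IsPositiveTimeField T' ρ M f) {t : ℝ} (ht : 0 < t) (x : Plane)
    (v : ℝ × Plane) (hv : ‖v‖ ≤ 1) :
    ‖fderiv ℝ f (t, x) v‖ ≤ M :=
  (ContinuousLinearMap.le_opNorm _ _).trans ((mul_le_mul (hf.norm_fderiv_le t ht x) hv
    (norm_nonneg _) ((norm_nonneg _).trans (hf.norm_fderiv_le t ht x))).trans_eq (mul_one M))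

theorem norm_spatial_le (hf : IsPositiveTimeField T' ρ M f) (o : Option (Fin 2)) (t : ℝ)
    (ht : 0 < t) (x : Plane) :
    ‖spatial o f (t, x)‖ ≤ M := by
  cases o with
  | none => exact hf.norm_le t ht x
  | some j => exact hf.norm_fderiv_apply_le ht x _ (by simp [Prod.norm_mk])

theorem spatial_timeShift (hη : 0 < η) (o : Option (Fin 2)) {t : ℝ} (ht : 0 < t) (x : Plane) :
    spatial o (timeShift f η) (t, x) = spatial o f (t + η, x) := by
  cases o with
  | none => exact timeShift_eq hη ht.le x
  | some j =>
    change fderiv ℝ (timeShift f η) (t, x) _ = fderiv ℝ f (t + η, x) _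
    rw [fderiv_timeShift hη ht]

end IsPositiveTimeField

/-! ### The approximating fields -/

instance instSecondCountableTopologyEitherRealH1Field :
    SecondCountableTopologyEither ℝ H1Field :=
  ⟨Or.inl inferInstance⟩

theorem H1Field.ofField_zero : H1Field.ofField (fun _ => 0) = 0 := by
  have hd : ContDiff ℝ 1 fun _ : Plane => (0 : Plane) := contDiff_const
  have hc : HasCompactSupport fun _ : Plane => (0 : Plane) := HasCompactSupport.zero
  have h0 : L2Field.ofField (fun _ => 0) = 0 := by
    rw [L2Field.ofField_of_memLp MemLp.zero']
    exact MemLp.toLp_zero _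
  refine H1Field.ext_component fun o => ?_
  rw [map_zero]
  cases o with
  | none => rw [H1Field.component_ofField_none hd hc, h0]
  | some j =>
    rw [H1Field.component_ofField_some hd hc]
    simpa using h0

/-- The field `f`, shifted in time by `η` and modified near the moving point at scale `η`. -/
def approxField (f : ℝ × Plane → Plane) (η : ℝ) (z : MovingFrame) : Plane :=
  timeShift f η (spaceTime z) - correction (timeShift f η) η z

namespace IsPositiveTimeField

variable {T' ρ M η : ℝ} {f : ℝ × Plane → Plane}

theorem contDiff_approxField (hf : IsPositiveTimeField T' ρ M f) (hη : 0 < η) :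
    ContDiff ℝ ∞ (approxField f η) :=
  ((hf.contDiff_timeShift hη).comp spaceTime.contDiff).sub
    (contDiff_correction (hf.contDiff_timeShift hη) (hf.hasCompactSupport_timeShift hη))

theorem hasLocallyCompactSupport_approxField (hf : IsPositiveTimeField T' ρ M f) (hη : 0 < η) :
    HasLocallyCompactSupport (approxField f η) :=
  (hasLocallyCompactSupport_comp_spaceTime (hf.hasCompactSupport_timeShift hη)).sub
    (hasLocallyCompactSupport_correction hη)

theorem approxField_eq_zero_of_le (hf : IsPositiveTimeField T' ρ M f) (hη : 0 < η) {t : ℝ}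
    (ht : T' ≤ t) (a x : Plane) : approxField f η ((t, a), x) = 0 := by
  have h := hf.timeShift_eq_zero_of_le hη ht
  rw [approxField, correction_eq_zero_of_time h, spaceTime_apply, h, sub_zero]

theorem approxField_eq_zero_of_mem_ball (hη : 0 < η) {t : ℝ} {a x : Plane}
    (hx : x ∈ Metric.ball a (η / 2)) : approxField f η ((t, a), x) = 0 := by
  rw [approxField, correction_eq_self hη, sub_self]
  rw [offset_apply]
  rwa [Metric.mem_ball, dist_eq_norm] at hx

theorem fderiv_approxField_apply (hf : IsPositiveTimeField T' ρ M f) (hη : 0 < η)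
    (z v : MovingFrame) : fderiv ℝ (approxField f η) z v
      = fderiv ℝ (timeShift f η) (spaceTime z) (spaceTime v)
        - fderiv ℝ (correction (timeShift f η) η) z v := by
  have h1 : HasFDerivAt (fun z : MovingFrame => timeShift f η (spaceTime z))
      ((fderiv ℝ (timeShift f η) (spaceTime z)).comp spaceTime) z :=
    (((hf.contDiff_timeShift hη).differentiable (by simp)) _).hasFDerivAt.comp z
      spaceTime.hasFDerivAt
  have h2 := (((contDiff_correction (η := η) (hf.contDiff_timeShift hη)
    (hf.hasCompactSupport_timeShift hη)).differentiable (by simp)) z).hasFDerivAt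
  have h3 : fderiv ℝ (approxField f η) z = _ := (h1.sub h2).fderiv
  rw [h3]
  rfl

theorem isDivFree_approxField (hf : IsPositiveTimeField T' ρ M f) (hη : 0 < η) (p : ℝ × Plane) :
    (h1Slice (approxField f η) p).IsDivFree := by
  have hd := hf.contDiff_approxField hη
  have hs := hf.hasLocallyCompactSupport_approxField hη
  have h : ∀ i : Fin 2, ∀ᵐ x : Plane, H1Field.partialDeriv i (h1Slice (approxField f η) p) x
      = fderiv ℝ (approxField f η) (p, x) (0, planeBasis i) := by
    intro i
    rw [← H1Field.component_some, component_h1Slice hs (hd.of_le (by norm_cast))]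
    exact L2Field.coeFn_ofField ((hs.spatial (some i)).memLp
      (contDiff_spatial hd (some i)).continuous p)
  filter_upwards [ae_all_iff.2 h] with x hx
  simp_rw [hx, hf.fderiv_approxField_apply hη]
  simp only [PiLp.sub_apply, Finset.sum_sub_distrib]
  rw [div_correction (hf.contDiff_timeShift hη) (hf.hasCompactSupport_timeShift hη)
    (hf.spaceDiv_timeShift hη), sub_zero]
  exact hf.spaceDiv_timeShift hη _

theorem toL2_approxField_eq_zero (hf : IsPositiveTimeField T' ρ M f) (hη : 0 < η) (t : ℝ)
    (a : Plane) : ∀ᵐ x : Plane, x ∈ Metric.ball a (η / 2) →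
      (h1Slice (approxField f η) (t, a)).toL2 x = 0 := by
  have hd := hf.contDiff_approxField hη
  have hs := hf.hasLocallyCompactSupport_approxField hη
  rw [← H1Field.component_none, component_h1Slice hs (hd.of_le (by norm_cast))]
  filter_upwards [L2Field.coeFn_ofField (hs.memLp hd.continuous (t, a))] with x hx hxb
  exact hx.trans (approxField_eq_zero_of_mem_ball hη hxb)

theorem memLp_slice {g : ℝ × Plane → Plane} (hg : ContinuousOn g (Ioi 0 ×ˢ univ))
    (h0 : ∀ t x, ρ < ‖x‖ → g (t, x) = 0) {t : ℝ} (ht : 0 < t) :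
    MemLp (fun x => g (t, x)) 2 (volume : Measure Plane) :=
  memLp_slice_of_continuousOn hg (fun t _ => h0 t) ht

theorem memLp_spatial_correction (hf : IsPositiveTimeField T' ρ M f) (hη : 0 < η)
    (o : Option (Fin 2)) (p : ℝ × Plane) :
    MemLp (fun x => spatial o (correction (timeShift f η) η) (p, x)) 2
      (volume : Measure Plane) :=
  ((hasLocallyCompactSupport_correction hη).spatial o).memLp
    (contDiff_spatial (contDiff_correction (hf.contDiff_timeShift hη)
      (hf.hasCompactSupport_timeShift hη)) o).continuous p

theorem memLp_fderiv_correction (hf : IsPositiveTimeField T' ρ M f) (hη : 0 < η)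
    (p : ℝ × Plane) (v : MovingFrame) :
    MemLp (fun x => fderiv ℝ (correction (timeShift f η) η) (p, x) v) 2
      (volume : Measure Plane) :=
  ((hasLocallyCompactSupport_correction hη).fderiv_apply v).memLp
    (((contDiff_correction (hf.contDiff_timeShift hη)
      (hf.hasCompactSupport_timeShift hη)).continuous_fderiv (by simp)).clm_apply
        continuous_const) p

/-- The splitting into a strongly convergent and a concentrating part, in the form used by
`tendsto_inner_l2Slice_sub`. -/
theorem component_approxField (hf : IsPositiveTimeField T' ρ M f) (hη : 0 < η) {t : ℝ}
    (ht : 0 < t) (a : Plane) (o : Option (Fin 2)) :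
    H1Field.component o (h1Slice (approxField f η) (t, a))
      = l2Slice (spatial o f) (t + η)
        - L2Field.ofField fun x => spatial o (correction (timeShift f η) η) ((t, a), x) := by
  rw [component_h1Slice (hf.hasLocallyCompactSupport_approxField hη)
    ((hf.contDiff_approxField hη).of_le (by norm_cast)), l2Slice, l2Slice,
    ← L2Field.ofField_sub (memLp_slice (hf.continuousOn_spatial o) (hf.spatial_eq_zero o)
      (by linarith)) (hf.memLp_spatial_correction hη o (t, a))]
  refine congrArg L2Field.ofField (funext fun x => ?_)
  rw [← spatial_timeShift hη o ht]
  cases o with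
  | none => rfl
  | some j => exact hf.fderiv_approxField_apply hη _ _

theorem component_fderiv_approxField (hf : IsPositiveTimeField T' ρ M f) (hη : 0 < η) {t : ℝ}
    (ht : 0 < t) (a b : Plane) :
    H1Field.component none (fderiv ℝ (h1Slice (approxField f η)) (t, a) (1, b))
      = l2Slice (fun z => fderiv ℝ f z (1, 0)) (t + η)
        - L2Field.ofField fun x =>
          fderiv ℝ (correction (timeShift f η) η) ((t, a), x) ((1, b), 0) := by
  have h0 : ∀ (t : ℝ) (x : Plane), ρ < ‖x‖ → fderiv ℝ f (t, x) (1, 0) = 0 := fun t x hx => by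
    rw [hf.fderiv_eq_zero_of_lt_norm t x hx, zero_apply]
  have hs := hf.hasLocallyCompactSupport_approxField hη
  have hd := hf.contDiff_approxField hη
  rw [fderiv_h1Slice_apply hs hd, component_h1Slice_fderiv_apply hs hd, l2Slice, l2Slice,
    ← L2Field.ofField_sub (memLp_slice (hf.continuousOn_fderiv_apply (1, 0)) h0
      (by linarith)) (hf.memLp_fderiv_correction hη (t, a) _)]
  refine congrArg L2Field.ofField (funext fun x => ?_)
  rw [← fderiv_timeShift hη ht]
  exact hf.fderiv_approxField_apply hη _ _

theorem exists_correction_bound (hf : IsPositiveTimeField T' ρ M f) (hM : 0 ≤ M) (hρ : 0 ≤ ρ) :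
    ∃ C : ℝ, 0 ≤ C ∧ ∀ η, 0 < η → η ≤ 1 → ∀ t, 0 < t → ∀ a x,
      ‖correction (timeShift f η) η ((t, a), x)‖ ≤ C / η ∧
        ‖fderiv ℝ (correction (timeShift f η) η) ((t, a), x)‖ ≤ C / η := by
  obtain ⟨C, hC, h⟩ := _root_.exists_correction_bound M ρ hM hρ
  refine ⟨C, hC, fun η hη hη1 t ht a x => h _ (hf.contDiff_timeShift hη)
    (hf.hasCompactSupport_timeShift hη) (hf.spaceDiv_timeShift hη) t (fun y => ?_) (fun y => ?_)
    (fun y hy => ?_) η hη hη1 a x⟩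
  · rw [timeShift_eq hη ht.le]
    exact hf.norm_le _ (by linarith) y
  · rw [fderiv_timeShift hη ht]
    exact hf.norm_fderiv_le _ (by linarith) y
  · rw [fderiv_timeShift hη ht]
    exact hf.fderiv_eq_zero_of_lt_norm _ y hy

end IsPositiveTimeField

theorem lt_norm_offset_of_notMem {η t : ℝ} {a x : Plane} (hx : x ∉ Metric.closedBall a η) :
    η < ‖offset ((t, a), x)‖ := by
  rw [Metric.mem_closedBall, dist_eq_norm, not_le] at hx
  exact hx

theorem spatial_correction_eq_zero {f : ℝ × Plane → Plane} {η t : ℝ} (hη : 0 < η) {a x : Plane}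
    (hx : x ∉ Metric.closedBall a η) (o : Option (Fin 2)) :
    spatial o (correction f η) ((t, a), x) = 0 := by
  have h := lt_norm_offset_of_notMem (t := t) hx
  cases o with
  | none => exact correction_eq_zero hη h
  | some j => simp [spatial, fderiv_correction_eq_zero hη h]

/-! ### Convergence of the approximating fields as η → 0 -/

namespace IsPositiveTimeField

variable {T T' ρ M : ℝ} {f : ℝ × Plane → Plane}

theorem aestronglyMeasurable_h1Slice (hf : IsPositiveTimeField T' ρ M f) :
    AEStronglyMeasurable (h1Slice f) (timeMeasure T) := by
  refine ContinuousOn.aestronglyMeasurable (fun t ht => ContinuousAt.continuousWithinAt ?_)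
    measurableSet_Ioo
  refine H1Field.continuousAt_of_component fun o => ?_
  refine (continuousAt_l2Slice_of_continuousOn (hf.continuousOn_spatial o)
    (fun t _ => hf.spatial_eq_zero o t) ht.1).congr ?_
  filter_upwards [isOpen_Ioi.mem_nhds ht.1] with s hs
  exact (hf.component_h1Slice_eq hs o).symm

theorem norm_h1Slice_le (hf : IsPositiveTimeField T' ρ M f) (hM : 0 ≤ M) {t : ℝ} (ht : 0 < t) :
    ‖h1Slice f t‖
      ≤ ∑ _o : Option (Fin 2), M * √(volume.real (Metric.closedBall (0 : Plane) ρ)) := by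
  refine (H1Field.norm_le_sum_component _).trans (Finset.sum_le_sum fun o _ => ?_)
  rw [hf.component_h1Slice_eq ht]
  exact norm_l2Slice_le (hf.continuousOn_spatial o) (fun t _ => hf.spatial_eq_zero o t) hM
    (hf.norm_spatial_le o) ht

theorem weakStarTendstoLinfty_approxField (hf : IsPositiveTimeField T' ρ M f) (hM : 0 ≤ M)
    (hρ : 0 ≤ ρ) {h : ℝ → Plane} (hcont : ContinuousOn h (Icc 0 T)) :
    WeakStarTendstoLinfty T (𝓝[>] (0 : ℝ)) (fun η t => h1Slice (approxField f η) (t, h t))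
      (h1Slice f) := by
  obtain ⟨C, hC, hCb⟩ := hf.exists_correction_bound hM hρ
  have hsp : ∀ η, 0 < η → η ≤ 1 → ∀ t, 0 < t → ∀ o a x,
      ‖spatial o (correction (timeShift f η) η) ((t, a), x)‖ ≤ C / η := by
    intro η hη hη1 t ht o a x
    cases o with
    | none => exact (hCb η hη hη1 t ht a x).1
    | some j =>
      refine (ContinuousLinearMap.le_opNorm _ _).trans ((mul_le_mul (hCb η hη hη1 t ht a x).2
        ?_ (norm_nonneg _) (by positivity)).trans_eq (mul_one _))
      simp [Prod.norm_mk]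
  have h1 : ∀ᶠ η : ℝ in 𝓝[>] 0, 0 < η ∧ η ≤ 1 := Ioc_mem_nhdsGT (zero_lt_one' ℝ)
  have hT : ∀ᵐ t ∂timeMeasure T, t ∈ Ioo 0 T := ae_restrict_mem measurableSet_Ioo
  refine weakStarTendstoLinfty_of_tendsto_inner
    (C := ∑ _o : Option (Fin 2), (M * √(volume.real (Metric.closedBall (0 : Plane) ρ))
      + C * discConst)) ?_ ?_ ?_ ?_
  · filter_upwards [h1] with η hη
    refine ContinuousOn.aestronglyMeasurable ?_ measurableSet_Ioo
    exact (continuous_h1Slice (hf.hasLocallyCompactSupport_approxField hη.1)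
      (hf.contDiff_approxField hη.1)).comp_continuousOn
        (continuousOn_id.prodMk (hcont.mono Ioo_subset_Icc_self))
  · refine memLp_top_of_bound hf.aestronglyMeasurable_h1Slice
      (∑ _o : Option (Fin 2), M * √(volume.real (Metric.closedBall (0 : Plane) ρ))) ?_
    filter_upwards [hT] with t ht using hf.norm_h1Slice_le hM ht.1
  · filter_upwards [h1] with η hη
    filter_upwards [hT] with t ht
    refine (H1Field.norm_le_sum_component _).trans (Finset.sum_le_sum fun o _ => ?_)
    rw [hf.component_approxField hη.1 ht.1]
    refine (norm_sub_le _ _).trans (add_le_add ?_ ?_)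
    · exact norm_l2Slice_le (hf.continuousOn_spatial o) (fun t _ => hf.spatial_eq_zero o t) hM
        (hf.norm_spatial_le o) (add_pos ht.1 hη.1)
    · exact norm_ofField_le_of_concentrated hη.1 (hf.memLp_spatial_correction hη.1 o (t, h t)) hC
        (hsp η hη.1 hη.2 t ht.1 o (h t)) fun x hx => spatial_correction_eq_zero hη.1 hx o
  · filter_upwards [hT] with t ht w
    simp_rw [H1Field.inner_eq_sum_component]
    refine tendsto_finsetSum _ fun o _ => ?_
    rw [hf.component_h1Slice_eq ht.1]
    refine (tendsto_inner_l2Slice_sub (hf.continuousOn_spatial o)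
      (fun t _ => hf.spatial_eq_zero o t) ht.1 (a := h t) hC
      (fun η hη _ => hf.memLp_spatial_correction hη o (t, h t))
      (fun η hη hη1 => hsp η hη hη1 t ht.1 o (h t))
      (fun η hη _ x hx => spatial_correction_eq_zero hη hx o) _).congr' ?_
    filter_upwards [h1] with η hη
    rw [hf.component_approxField hη.1 ht.1]

/-- At a fixed time, h t and h' t are constants, so the weak convergence is that for a point at
rest. The motion enters only through the factor 1 + ‖h' t‖ in the bound. -/
theorem weaklyTendstoLq_fderiv_approxField (hf : IsPositiveTimeField T' ρ M f) (hM : 0 ≤ M)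
    (hρ : 0 ≤ ρ) (hT0 : 0 < T) {q : ℝ≥0∞} [Fact (1 ≤ q)] (hq : q ≤ 2) {h h' : ℝ → Plane}
    (hW : IsW1q q T h h') (hcont : ContinuousOn h (Icc 0 T)) :
    WeaklyTendstoLq q T (𝓝[>] (0 : ℝ))
      (fun η t => (fderiv ℝ (h1Slice (approxField f η)) (t, h t) (1, h' t)).toL2)
      (l2Slice fun z => fderiv ℝ f z (1, 0)) := by
  obtain ⟨C, hC, hCb⟩ := hf.exists_correction_bound hM hρ
  have hgc := hf.continuousOn_fderiv_apply (1, 0)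
  have hg0 : ∀ t : ℝ, 0 < t → ∀ x : Plane, ρ < ‖x‖ → fderiv ℝ f (t, x) (1, 0) = 0 :=
    fun t _ x hx => by rw [hf.fderiv_eq_zero_of_lt_norm t x hx, zero_apply]
  have hgM : ∀ t : ℝ, 0 < t → ∀ x : Plane, ‖fderiv ℝ f (t, x) (1, 0)‖ ≤ M :=
    fun t ht x => hf.norm_fderiv_apply_le ht x _ (by simp [Prod.norm_mk])
  have hrb : ∀ η, 0 < η → η ≤ 1 → ∀ t, 0 < t → ∀ a b x,
      ‖fderiv ℝ (correction (timeShift f η) η) ((t, a), x) ((1, b), 0)‖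
        ≤ C * (1 + ‖b‖) / η := by
    intro η hη hη1 t ht a b x
    refine (ContinuousLinearMap.le_opNorm _ _).trans ((mul_le_mul (hCb η hη hη1 t ht a x).2
      (?_ : _ ≤ 1 + ‖b‖) (norm_nonneg _) (by positivity)).trans_eq (by ring))
    rw [Prod.norm_mk, Prod.norm_mk, norm_one, norm_zero]
    exact max_le (max_le (by linarith [norm_nonneg b]) (by linarith)) (by positivity)
  have hr0 : ∀ η, 0 < η → ∀ (t : ℝ) (a b x : Plane), x ∉ Metric.closedBall a η →
      fderiv ℝ (correction (timeShift f η) η) ((t, a), x) ((1, b), 0) = 0 := by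
    intro η hη t a b x hx
    rw [fderiv_correction_eq_zero hη (lt_norm_offset_of_notMem hx), zero_apply]
  have h1 : ∀ᶠ η : ℝ in 𝓝[>] 0, 0 < η ∧ η ≤ 1 := Ioc_mem_nhdsGT (zero_lt_one' ℝ)
  have hT : ∀ᵐ t ∂timeMeasure T, t ∈ Ioo 0 T := ae_restrict_mem measurableSet_Ioo
  set A := M * √(volume.real (Metric.closedBall (0 : Plane) ρ)) with hA
  -- A controls the shifted ∂ₜf, and the second term the derivative of the correction along (1, h'
  -- t).
  have hm : MemLp (fun t => A + C * (1 + ‖h' t‖) * discConst) q (timeMeasure T) :=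
    MemLp.add (f := fun _ => A) (memLp_const A) (((MemLp.add (f := fun _ => (1 : ℝ))
      (memLp_const 1) hW.memLp_deriv.norm).const_mul C).mul_const discConst)
  have hu₀b : ∀ᵐ t ∂timeMeasure T, ‖l2Slice (fun z => fderiv ℝ f z (1, 0)) t‖ ≤ A := by
    filter_upwards [hT] with t ht using norm_l2Slice_le hgc hg0 hM hgM ht.1
  refine weaklyTendstoLq_of_tendsto_inner hq hm ?_ ?_ ?_ ?_ ?_
  · filter_upwards [h1] with η hη
    exact (H1Field.component none).comp_memLp' (hW.comp_contDiff Fact.out hT0 hcont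
      (contDiff_h1Slice (hf.hasLocallyCompactSupport_approxField hη.1)
        (hf.contDiff_approxField hη.1))).memLp_deriv
  · refine MemLp.of_bound (ContinuousOn.aestronglyMeasurable (fun t ht => ?_) measurableSet_Ioo)
      A hu₀b
    exact (continuousAt_l2Slice_of_continuousOn hgc hg0 ht.1).continuousWithinAt
  · filter_upwards [h1] with η hη
    filter_upwards [hT] with t ht
    rw [← H1Field.component_none, hf.component_fderiv_approxField hη.1 ht.1]
    refine (norm_sub_le _ _).trans (add_le_add ?_ ?_)
    · exact norm_l2Slice_le hgc hg0 hM hgM (add_pos ht.1 hη.1)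
    · exact norm_ofField_le_of_concentrated hη.1 (hf.memLp_fderiv_correction hη.1 (t, h t) _)
        (by positivity) (hrb η hη.1 hη.2 t ht.1 (h t) (h' t)) (hr0 η hη.1 t (h t) (h' t))
  · filter_upwards [hu₀b] with t ht
    have := discConst_nonneg
    exact ht.trans (le_add_of_nonneg_right (by positivity))
  · filter_upwards [hT] with t ht w
    refine (tendsto_inner_l2Slice_sub hgc hg0 ht.1 (a := h t) (C := C * (1 + ‖h' t‖))
      (by positivity) (fun η hη _ => hf.memLp_fderiv_correction hη (t, h t) ((1, h' t), 0))
      (fun η hη hη1 => hrb η hη hη1 t ht.1 (h t) (h' t))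
      (fun η hη _ => hr0 η hη t (h t) (h' t)) w).congr' ?_
    filter_upwards [h1] with η hη
    rw [← H1Field.component_none, hf.component_fderiv_approxField hη.1 ht.1]

end IsPositiveTimeField

theorem WeakStarTendstoLinfty.congr_right {X : Type*} [NormedAddCommGroup X] [NormedSpace ℝ X]
    [CompleteSpace X] {ι : Type*} {T : ℝ} {l : Filter ι} {u : ι → ℝ → X} {u₀ v₀ : ℝ → X}
    (h : WeakStarTendstoLinfty T l u u₀) (huv : u₀ =ᵐ[timeMeasure T] v₀) :
    WeakStarTendstoLinfty T l u v₀ := by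
  refine ⟨h.1, (memLp_congr_ae huv).1 h.2.1, fun w hw => ?_⟩
  have h1 : ∫ t in Ioo 0 T, w t (u₀ t) = ∫ t in Ioo 0 T, w t (v₀ t) :=
    integral_congr_ae (huv.mono fun t ht => by simp only [ht])
  rw [← h1]
  exact h.2.2 w hw

theorem WeaklyTendstoLq.congr_right {X : Type*} [NormedAddCommGroup X] [NormedSpace ℝ X]
    [CompleteSpace X] {ι : Type*} {q : ℝ≥0∞} [Fact (1 ≤ q)] {T : ℝ} {l : Filter ι}
    {u : ι → ℝ → X} {u₀ v₀ : ℝ → X} (h : WeaklyTendstoLq q T l u u₀)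
    (huv : u₀ =ᵐ[timeMeasure T] v₀) : WeaklyTendstoLq q T l u v₀ := by
  obtain ⟨U, U₀, h1, h2, h3⟩ := h
  exact ⟨U, U₀, h1, h2.trans huv, h3⟩

end

theorem proposition4 (T : ℝ) (hT : 0 < T)
    (q : ℝ≥0∞) [Fact (1 ≤ q)] (hq1 : 1 < q) (hq2 : q < 2)
    (h h' : ℝ → Plane) (hW : IsW1q q T h h') (hcont : ContinuousOn h (Icc 0 T))
    (φ : ℝ → Plane → Plane) (hφ : IsTestField T φ)
    (hdiv : ∀ t ∈ Ico 0 T, ∀ x, classicalDiv (φ t) x = 0) :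
    ∃ Φ dΦ : ℝ → ℝ → H1Field,
      (∀ η : ℝ, 0 < η →
        IsW1qc q T (Φ η) (dΦ η) ∧
        (∀ t ∈ Ico 0 T, (Φ η t).IsDivFree) ∧
        (∀ t ∈ Ico 0 T, ∀ᵐ x : Plane, x ∈ Metric.ball (h t) (η / 2) →
          (Φ η t).toL2 x = 0)) ∧
      WeakStarTendstoLinfty T (𝓝[>] (0 : ℝ)) Φ (fun t => H1Field.ofField (φ t)) ∧
      WeaklyTendstoLq q T (𝓝[>] (0 : ℝ)) (fun η t => (dΦ η t).toL2)
        (fun t => L2Field.ofField fun x => deriv (fun s => φ s x) t) := by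
  obtain ⟨f, T', ρ, M, hT', hρ, hM, hf, hfφ⟩ := hφ.exists_isPositiveTimeField hT hdiv
  have hTae : ∀ᵐ t ∂timeMeasure T, t ∈ Ioo 0 T := ae_restrict_mem measurableSet_Ioo
  refine ⟨fun η t => h1Slice (approxField f η) (t, h t),
    fun η t => fderiv ℝ (h1Slice (approxField f η)) (t, h t) (1, h' t), fun η hη => ⟨?_, ?_, ?_⟩,
    (hf.weakStarTendstoLinfty_approxField hM hρ hcont).congr_right ?_,
    (hf.weaklyTendstoLq_fderiv_approxField hM hρ hT hq2.le hW hcont).congr_right ?_⟩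
  · have hs := hf.hasLocallyCompactSupport_approxField hη
    have hd := hf.contDiff_approxField hη
    exact
      { toIsW1q := hW.comp_contDiff hq1.le hT hcont (contDiff_h1Slice hs hd)
        continuousOn := (continuous_h1Slice hs hd).comp_continuousOn
          (continuousOn_id.prodMk (hcont.mono Ico_subset_Icc_self))
        -- The shift moves the support to earlier times, so T' serves every η.
        compactSupport := ⟨T', hT', fun t ht => by
          simp only [h1Slice, hf.approxField_eq_zero_of_le hη ht.1]
          exact H1Field.ofField_zero⟩ }
  · exact fun t _ => hf.isDivFree_approxField hη (t, h t)
  · exact fun t _ => hf.toL2_approxField_eq_zero hη t (h t)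
  -- f agrees with φ on (0, T), which is all that the time measure sees.
  · filter_upwards [hTae] with t ht
    simp only [h1Slice, hfφ t ht]
  · filter_upwards [hTae] with t ht
    refine congrArg L2Field.ofField (funext fun x => ?_)
    have h1 : (fun s => φ s x) =ᶠ[𝓝 t] fun s => f (s, x) := by
      filter_upwards [isOpen_Ioo.mem_nhds ht] with s hs
      exact (hfφ s hs x).symm
    have h2 : HasDerivAt (fun s : ℝ => (s, x)) (1, 0) t :=
      (hasDerivAt_id t).prodMk (hasDerivAt_const t x)
    rw [h1.deriv_eq]
    exact ((hf.differentiableAt ht.1 x).hasFDerivAt.comp_hasDerivAt t h2).deriv.symm
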